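/- **Setting.** An instance consists of $m$ processors and $n$ jobs; job $j$ has a release time $r_j$, a deadline $d_j$ and a processing volume $p_j$ (non-negative integers). Let $d=\max_j d_j$ and $T=\{0,\dots,d\}$. In a feasible schedule every job $j$ is processed in exactly $p_j$ slots of $E_j=\{r_j,\dots,d_j\}$, no processor handles two jobs in the same slot, and no job runs on two processors in the same slot. For bounds $l,u:T\to\mathbb N$, a feasible schedule respects $(l,u)$ if in every slot $t\in T$ the number of busy processors lies in $[l_t,u_t]$. **Algorithm PLTR** (Parallel Left-to-Right). Start with $u_t=m$ and $l_t=0$ for all $t\in T$. For $k=m,m-1,\dots,1$: set $t\leftarrow 0$ and, while $t\le d$, * (keepidle) let $t'\in[t,d+1]$ be maximal such that some feasible schedule respects the bounds after setting $u_s\leftarrow k-1$ for all $s\in[t,t')$; perform this update and set $t\leftarrow t'$; * (keepbusy) let $t'\in[t,d+1]$ be maximal such that some feasible schedule respects the bounds after setting $l_s\leftarrow\max\{k,l_s\}$ for all $s\in[t,t')$; perform this update and set $t\leftarrow t'$. PLTR returns the final bounds $(l,u)$, together with a feasible schedule that respects them and uses lower-numbered processors first. **Implementation and cost model.** Elementary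 operations on integers and table accesses take unit time. Only the first $\min\{m,n\}$ processors are considered, and keepbusy is skipped when no slots remain. The bounds are stored on a partition of $T$ into time intervals, which is split at all $r_j$, at all $d_j+1$, and wherever a bound changes. The value $t'$ is found by binary search. A feasibility check first tests $l\le u$ and $\sum_t l_t\le P:=\sum_j p_j$. It then tests whether the maximum $\alpha$-$\omega$ flow has value $P$ in the network with nodes $\alpha,\gamma,\omega$, a node $u_j$ for every job $j$, and a node $v_i$ for every time interval $i$ (of length $\Delta_i$, with bounds $l_i,u_i$). Its capacities are: $p_j$ on $(\alpha,u_j)$; $\Delta_i$ on $(u_j,v_i)$ if $i\subseteq E_j$, and $0$ otherwise; $(u_i-l_i)\Delta_i$ on $(v_i,\gamma)$; $l_i\Delta_i$ on $(v_i,\omega)$; and $P-\sum_t l_t$ on $(\gamma,\omega)$. The schedule is read off from a maximum flow under the final bounds, by filling the processors one after the other (wrap-around) within each time interval. Flows are computed by an arbitrary algorithm $A$ that returns an integral maximum flow for every network with integral capacities, as a table indexed by pairs of nodes; on a network with $N$ nodes it takes at least $N^2$ steps, the number of entries of this table. **Theorem.** There are absolute constants $c,C$ such that the following holds for every maximum-flow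 algorithm $A$ as above, every instance with $d\ge 2$ that has a feasible schedule, and every $f\in\mathbb N$ such that $A$ takes at most $f$ steps on every network with at most $c\,n$ nodes. The implementation returns the bounds computed by PLTR (stored on a partition of $T$ into time intervals), together with a feasible schedule that respects these bounds and uses lower-numbered processors first, and it takes at most $$C\, n\, f\, \log d$$ steps. That is, PLTR runs in time $O(n f\log d)$, where $f$ is the time of one maximum-flow computation in a network with $O(n)$ nodes. -/

import Mathlib

open scoped BigOperators

namespace PowerDown

/-! ## The scheduling problem -/

/-- A job with release time, deadline and processing volume. -/
structure Job where
  release : ℕ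
  deadline : ℕ
  volume : ℕ

/-- A problem instance with `n` jobs and `m` parallel processors. (The energy needed for turning a
processor on is not used by the algorithm and hence plays no role here.) -/
structure Instance (n : ℕ) where
  m : ℕ
  job : Fin n → Job

/-- A schedule on `m` processors: which job, if any, processor `k` processes in slot `t`.
Processor number `k + 1` of the usual numbering `1, …, m` is the element `k` of `Fin m`. -/
abbrev Schedule (m n : ℕ) := Fin m → ℕ → Option (Fin n)

/-- The number of busy processors in slot `t`. -/
def Schedule.vol {m n : ℕ} (σ : Schedule m n) (t : ℕ) : ℕ :=
  (Finset.univ.filter fun k => (σ k t).isSome).card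

/-- In every slot, the lower-numbered processors are used first. -/
def Schedule.Stair {m n : ℕ} (σ : Schedule m n) : Prop :=
  ∀ t k k', k' ≤ k → (σ k t).isSome → (σ k' t).isSome

/-- Lower and upper bounds `l_t`, `m_t` for the number of busy processors. -/
structure Bounds where
  lo : ℕ → ℕ
  up : ℕ → ℕ

/-- `m_s ← k - 1` for all `s ∈ [t, t')`. -/
def Bounds.setIdle (B : Bounds) (k t t' : ℕ) : Bounds where
  lo := B.lo
  up := fun s => if t ≤ s ∧ s < t' then k - 1 else B.up s

/-- `l_s ← max {k, l_s}` for all `s ∈ [t, t')`. -/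
def Bounds.setBusy (B : Bounds) (k t t' : ℕ) : Bounds where
  lo := fun s => if t ≤ s ∧ s < t' then max k (B.lo s) else B.lo s
  up := B.up

namespace Instance

variable {n : ℕ} (I : Instance n)

/-- The last deadline. The time slots are `0, …, d`. -/
def d : ℕ := Finset.univ.sup fun j => (I.job j).deadline

/-- Feasibility of a schedule: jobs are only processed within their execution intervals
`[r_j, d_j]`, no job is processed by two processors in the same slot, and every job `j` is processed
in exactly `p_j` slots. -/
structure IsFeasible (σ : Schedule I.m n) : Prop where
  window : ∀ k t j, σ k t = some j → (I.job j).release ≤ t ∧ t ≤ (I.job j).deadline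
  no_parallel : ∀ t j k k', σ k t = some j → σ k' t = some j → k = k'
  volume : ∀ j,
    ((Finset.range (I.d + 1)).filter fun t => ∃ k, σ k t = some j).card = (I.job j).volume

/-- The instance admits a feasible schedule. -/
def Feasible : Prop := ∃ σ, I.IsFeasible σ

/-- The schedule respects the bounds in every time slot. -/
def Respects (σ : Schedule I.m n) (B : Bounds) : Prop :=
  ∀ t ≤ I.d, B.lo t ≤ σ.vol t ∧ σ.vol t ≤ B.up t

/-- Feasibility of the instance of deadline-scheduling-with-processor-bounds given by `B`. -/
def FeasibleWith (B : Bounds) : Prop := ∃ σ, I.IsFeasible σ ∧ I.Respects σ B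

/-! ## The algorithm PLTR, as a specification -/

/-- `t'` is the return value of `keepidle(k, t)` called under the bounds `B`: the maximal end of an
interval `[t, t')` in which processor `k` can be kept idle
(`t' = t` if it cannot even be kept idle in slot `t`). -/
def IsKeepIdle (B : Bounds) (k t t' : ℕ) : Prop :=
  IsGreatest {s | t ≤ s ∧ s ≤ I.d + 1 ∧ I.FeasibleWith (B.setIdle k t s)} t'

/-- `t'` is the return value of `keepbusy(k, t)` called under the bounds `B`. -/
def IsKeepBusy (B : Bounds) (k t t' : ℕ) : Prop :=
  IsGreatest {s | t ≤ s ∧ s ≤ I.d + 1 ∧ I.FeasibleWith (B.setBusy k t s)} t'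

/-- The `while`-loop for processor `k`, entered with the current value of `t` and the bounds `B`,
terminates with the bounds `B'`. -/
inductive ScanProcessor (k : ℕ) : ℕ → Bounds → Bounds → Prop
  | done (t : ℕ) (B : Bounds) : I.d < t → ScanProcessor k t B B
  | step (t t₁ t₂ : ℕ) (B B' : Bounds) : t ≤ I.d →
      I.IsKeepIdle B k t t₁ →
      I.IsKeepBusy (B.setIdle k t t₁) k t₁ t₂ →
      ScanProcessor k t₂ ((B.setIdle k t t₁).setBusy k t₁ t₂) B' →
      ScanProcessor k t B B'

/-- The `for`-loop over the processors `k, k - 1, …, 1`. -/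
inductive ScanProcessors : ℕ → Bounds → Bounds → Prop
  | zero (B : Bounds) : ScanProcessors 0 B B
  | succ (k : ℕ) (B B' B'' : Bounds) : I.ScanProcessor (k + 1) 0 B B' →
      ScanProcessors k B' B'' → ScanProcessors (k + 1) B B''

/-- PLTR terminates on the instance and returns the bounds `B`. -/
def PLTRReturns (B : Bounds) : Prop :=
  I.ScanProcessors I.m ⟨fun _ => 0, fun _ => I.m⟩ B

end Instance

/-! ## Step counting

A computation with a step count. One unit is charged for every round of every loop and every call of
a recursive function; in between only a bounded number of elementary operations takes place
(arithmetic and comparison of numbers, access to an entry of a table, prepending to a list). -/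

/-- A value together with the number of steps used for computing it. -/
structure Timed (α : Type) where
  val : α
  time : ℕ

namespace Timed

instance : Monad Timed where
  pure a := ⟨a, 0⟩
  bind x g := ⟨(g x.val).val, x.time + (g x.val).time⟩

/-- Spend `k` steps. -/
def tick (k : ℕ) : Timed Unit := ⟨(), k⟩

/-- A loop over the entries of a list. -/
def fold {α β : Type} (body : β → α → Timed β) : β → List α → Timed β
  | b, [] => do
    tick 1
    pure b
  | b, a :: l => do
    tick 1
    let b' ← body b a
    fold body b' l

/-- Binary search for the maximal `x ∈ [a, b]` that passes the test, where `a` is known to pass. -/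
def search (test : ℕ → Timed Bool) (a b : ℕ) : Timed ℕ :=
  if h : a < b then do
    tick 1
    let ok ← test ((a + b + 1) / 2)
    if ok then search test ((a + b + 1) / 2) b else search test a ((a + b + 1) / 2 - 1)
  else do
    tick 1
    pure a
termination_by b - a
decreasing_by all_goals omega

end Timed

open Timed

/-! ## Maximum flows -/

/-- A flow network with integral capacities. -/
structure FlowNetwork (V : Type) where
  cap : V → V → ℕ
  source : V
  sink : V

namespace FlowNetwork

variable {V : Type} [Fintype V] (G : FlowNetwork V)

/-- An integral flow: capacity constraints and flow conservation. -/
structure IsFlow (φ : V → V → ℕ) : Prop where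
  le_cap : ∀ u v, φ u v ≤ G.cap u v
  conserve : ∀ v, v ≠ G.source → v ≠ G.sink → ∑ u, φ u v = ∑ w, φ v w

/-- The value of a flow. -/
def value (φ : V → V → ℕ) : ℤ := ∑ v, (φ G.source v : ℤ) - ∑ v, (φ v G.source : ℤ)

/-- A flow of maximum value. -/
def IsMaxFlow (φ : V → V → ℕ) : Prop := G.IsFlow φ ∧ ∀ ψ, G.IsFlow ψ → G.value ψ ≤ G.value φ

end FlowNetwork

/-- A maximum-flow algorithm. It takes at least as many steps as the flow table that it returns has
entries. -/
structure MaxFlowSolver where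
  solve : ∀ {V : Type} [Fintype V] [DecidableEq V], FlowNetwork V → Timed (V → V → ℕ)
  isMaxFlow : ∀ {V : Type} [Fintype V] [DecidableEq V] (G : FlowNetwork V),
    G.IsMaxFlow (solve G).val
  card_sq_le : ∀ {V : Type} [Fintype V] [DecidableEq V] (G : FlowNetwork V),
    Fintype.card V ^ 2 ≤ (solve G).time

/-! ## The algorithm PLTR, as a step-counted program

The bounds `l_t`, `m_t` are stored for time intervals instead of individual slots. -/

/-- The slots `start, …, finish - 1`, with the common values of the bounds there. -/
structure Seg where
  start : ℕ
  finish : ℕ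
  lo : ℕ
  up : ℕ

/-- The job `job` runs on processor `proc` (counted from `0`) in the slots `start, …, finish - 1`. -/
structure Piece (n : ℕ) where
  proc : ℕ
  job : Fin n
  start : ℕ
  finish : ℕ

/-- The output: the final bounds, and a schedule. -/
structure Output (n : ℕ) where
  segs : List Seg
  pieces : List (Piece n)

/-- The list of segments partitions the time slots and stores the bounds `B`. -/
def Instance.Stores {n : ℕ} (I : Instance n) (segs : List Seg) (B : Bounds) : Prop :=
  (∀ t ≤ I.d, ∃! i : Fin segs.length, (segs.get i).start ≤ t ∧ t < (segs.get i).finish) ∧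
  (∀ s ∈ segs, ∀ t, s.start ≤ t → t < s.finish → t ≤ I.d ∧ B.lo t = s.lo ∧ B.up t = s.up)

/-- The list of pieces describes the schedule `σ`. -/
def Describes {m n : ℕ} (pieces : List (Piece n)) (σ : Schedule m n) : Prop :=
  (∀ q ∈ pieces, ∀ t, q.start ≤ t → t < q.finish → ∃ h : q.proc < m, σ ⟨q.proc, h⟩ t = some q.job) ∧
  (∀ k t j, σ k t = some j →
    ∃ q ∈ pieces, q.proc = k ∧ q.job = j ∧ q.start ≤ t ∧ t < q.finish)

/-- Split the segment that has `x` in its interior. -/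
def splitAt (x : ℕ) : List Seg → Timed (List Seg)
  | [] => do
    tick 1
    pure []
  | s :: l => do
    tick 1
    if s.start < x ∧ x < s.finish then
      pure (⟨s.start, x, s.lo, s.up⟩ :: ⟨x, s.finish, s.lo, s.up⟩ :: l)
    else
      let l' ← splitAt x l
      pure (s :: l')

/-- Replace the upper bound by `k - 1` on all segments within `[t, t')`. -/
def lowerUp (k t t' : ℕ) : List Seg → Timed (List Seg)
  | [] => do
    tick 1
    pure []
  | s :: l => do
    tick 1
    let l' ← lowerUp k t t' l
    if t ≤ s.start ∧ s.finish ≤ t' then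
      pure (⟨s.start, s.finish, s.lo, k - 1⟩ :: l')
    else
      pure (s :: l')

/-- Raise the lower bound to at least `k` on all segments within `[t, t')`. -/
def raiseLo (k t t' : ℕ) : List Seg → Timed (List Seg)
  | [] => do
    tick 1
    pure []
  | s :: l => do
    tick 1
    let l' ← raiseLo k t t' l
    if t ≤ s.start ∧ s.finish ≤ t' then
      pure (⟨s.start, s.finish, max k s.lo, s.up⟩ :: l')
    else
      pure (s :: l')

/-- `m_s ← k - 1` for all `s ∈ [t, t')`, on the list of segments. -/
def setIdleSegs (k t t' : ℕ) (segs : List Seg) : Timed (List Seg) := do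
  let segs₁ ← splitAt t segs
  let segs₂ ← splitAt t' segs₁
  lowerUp k t t' segs₂

/-- `l_s ← max {k, l_s}` for all `s ∈ [t, t')`, on the list of segments. -/
def setBusySegs (k t t' : ℕ) (segs : List Seg) : Timed (List Seg) := do
  let segs₁ ← splitAt t segs
  let segs₂ ← splitAt t' segs₁
  raiseLo k t t' segs₂

/-- The nodes of the network: jobs, time intervals, and the three nodes `α`, `γ`, `ω`. -/
abbrev Node (n s : ℕ) := Fin n ⊕ Fin s ⊕ Fin 3

namespace Node

variable {n s : ℕ}

/-- The node of job `j`. -/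
abbrev job (j : Fin n) : Node n s := Sum.inl j
/-- The node of the `i`-th time interval. -/
abbrev interval (i : Fin s) : Node n s := Sum.inr (Sum.inl i)
/-- The source. -/
abbrev alpha : Node n s := Sum.inr (Sum.inr 0)
/-- The intermediate node between the time intervals and the sink. -/
abbrev gamma : Node n s := Sum.inr (Sum.inr 1)
/-- The sink. -/
abbrev omega : Node n s := Sum.inr (Sum.inr 2)

end Node

/-- The network for checking feasibility, with one node per time interval. Here `P` is the total
volume and `L` is the sum of the lower bounds `l_t` over all time slots `t`. -/
def network {n : ℕ} (I : Instance n) (segs : List Seg) (P L : ℕ) :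
    FlowNetwork (Node n segs.length) where
  source := Node.alpha
  sink := Node.omega
  cap
    | Sum.inr (Sum.inr 0), Sum.inl j => (I.job j).volume
    | Sum.inl j, Sum.inr (Sum.inl i) =>
        if (I.job j).release ≤ (segs.get i).start ∧ (segs.get i).finish ≤ (I.job j).deadline + 1 then
          (segs.get i).finish - (segs.get i).start
        else 0
    | Sum.inr (Sum.inl i), Sum.inr (Sum.inr 1) =>
        ((segs.get i).up - (segs.get i).lo) * ((segs.get i).finish - (segs.get i).start)
    | Sum.inr (Sum.inl i), Sum.inr (Sum.inr 2) =>
        (segs.get i).lo * ((segs.get i).finish - (segs.get i).start)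
    | Sum.inr (Sum.inr 1), Sum.inr (Sum.inr 2) => P - L
    | _, _ => 0

section Program

variable (A : MaxFlowSolver) {n : ℕ} (I : Instance n)

/-- The last deadline. -/
def lastDeadline : Timed ℕ :=
  fold (fun x j => pure (max x (I.job j).deadline)) 0 (List.finRange n)

/-- The total volume `P`. -/
def totalVolume : Timed ℕ :=
  fold (fun x j => pure (x + (I.job j).volume)) 0 (List.finRange n)

/-- The sum of the lower bounds over all time slots. -/
def totalLo (segs : List Seg) : Timed ℕ :=
  fold (fun x s => pure (x + s.lo * (s.finish - s.start))) 0 segs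

/-- Whether the lower bounds do not exceed the upper bounds. -/
def ordered (segs : List Seg) : Timed Bool :=
  fold (fun b s => pure (b && decide (s.lo ≤ s.up))) true segs

/-- Write down the table of capacities, and compute a maximum flow. -/
def runFlow (segs : List Seg) (P L : ℕ) :
    Timed (Node n segs.length → Node n segs.length → ℕ) := do
  tick (Fintype.card (Node n segs.length) ^ 2)
  A.solve (network I segs P L)

/-- The check for feasibility. -/
def check (segs : List Seg) : Timed Bool := do
  let P ← totalVolume I
  let L ← totalLo segs
  let ok ← ordered segs
  if ok = true ∧ L ≤ P then
    let φ ← runFlow A I segs P L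
    let v ← fold (fun x j => pure (x + φ Node.alpha (Node.job j))) 0 (List.finRange n)
    pure (decide (v = P))
  else
    pure false

/-- The function `keepidle`: returns `t'` and the updated bounds. -/
def keepIdle (d k t : ℕ) (segs : List Seg) : Timed (ℕ × List Seg) := do
  let t' ← search (fun x => do
    let segs' ← setIdleSegs k t x segs
    check A I segs') t (d + 1)
  let segs' ← setIdleSegs k t t' segs
  pure (t', segs')

/-- The function `keepbusy`: returns `t'` and the updated bounds. -/
def keepBusy (d k t : ℕ) (segs : List Seg) : Timed (ℕ × List Seg) := do
  let t' ← search (fun x => do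
    let segs' ← setBusySegs k t x segs
    check A I segs') t (d + 1)
  let segs' ← setBusySegs k t t' segs
  pure (t', segs')

/-- The `while`-loop for processor `k`, with a limit on the number of rounds (which only serves to
make the definition total). The call of `keepbusy` is skipped once no time slots are left. -/
def scan (d k : ℕ) : ℕ → ℕ → List Seg → Timed (List Seg)
  | 0, _, segs => do
    tick 1
    pure segs
  | rounds + 1, t, segs => do
    tick 1
    if d < t then
      pure segs
    else
      let r₁ ← keepIdle A I d k t segs
      if d < r₁.1 then
        pure r₁.2
      else
        let r₂ ← keepBusy A I d k r₁.1 r₁.2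
        scan d k rounds r₂.1 r₂.2

/-- The `for`-loop over the processors `k, …, 1`. -/
def scanAll (d : ℕ) : ℕ → List Seg → Timed (List Seg)
  | 0, segs => do
    tick 1
    pure segs
  | k + 1, segs => do
    tick 1
    let segs' ← scan A I d (k + 1) (d + 1) 0 segs
    scanAll d k segs'

/-- The schedule within a single time interval of length `len` from its column of the flow table:
processors `0, 1, …` are filled one after the other, and a job that does not fit on the current
processor continues at the beginning of the interval on the next processor. The state consists of
the current processor, the current offset, and the pieces so far. -/
def fillInterval (start len : ℕ) (x : Fin n → ℕ) (pieces : List (Piece n)) :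
    Timed (List (Piece n)) := do
  let r ← fold (fun (st : ℕ × ℕ × List (Piece n)) j =>
    if st.2.1 + x j < len then
      pure (st.1, st.2.1 + x j, ⟨st.1, j, start + st.2.1, start + st.2.1 + x j⟩ :: st.2.2)
    else
      pure (st.1 + 1, st.2.1 + x j - len,
        ⟨st.1 + 1, j, start, start + (st.2.1 + x j - len)⟩ ::
        ⟨st.1, j, start + st.2.1, start + len⟩ :: st.2.2))
    (0, 0, pieces) (List.finRange n)
  pure r.2.2

/-- The schedule obtained from a maximum flow under the final bounds. -/
def extract (segs : List Seg) : Timed (List (Piece n)) := do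
  let P ← totalVolume I
  let L ← totalLo segs
  let φ ← runFlow A I segs P L
  fold (fun pieces i => fillInterval (segs.get i).start ((segs.get i).finish - (segs.get i).start)
    (fun j => φ (Node.job j) (Node.interval i)) pieces) [] (List.finRange segs.length)

/-- The algorithm PLTR. Only the first `min m n` processors are considered, the time horizon is split
at all release times and behind all deadlines. -/
def pltr : Timed (Output n) := do
  let d ← lastDeadline I
  let segs₀ ← fold (fun segs j => do
    let segs₁ ← splitAt (I.job j).release segs
    splitAt ((I.job j).deadline + 1) segs₁)
    [⟨0, d + 1, 0, min I.m n⟩] (List.finRange n)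
  let segs ← scanAll A I d (min I.m n) segs₀
  let pieces ← extract A I segs
  pure ⟨segs, pieces⟩

end Program

end PowerDown

/-! The running time is the number of rounds times the cost of a round. The crux is that all scans
together have at most `4 * n` rounds (`CountedScans.rounds_le_mul`).

Fix a feasible schedule `σ` that respects the final bounds. Bounds only tighten, so `σ` respects
every intermediate pair of bounds too. During the scan for processor `k`, its volume is therefore
below `k` on idle stretches and at least `k` on busy ones. Maximality makes a busy stretch nonempty
while slots remain, and makes an idle stretch nonempty if it follows a busy one that ended inside
the horizon. Hence, apart from at most two rounds per scan, every round exhibits its own slot at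
which the volume climbs from below `k` to at least `k`. Summed over `k`, the climbs number at most
the sum of the positive increments of the volume of `σ`.

This sum is at most `2 * n` by a potential argument. Suppose the volume increases at `x`, to the
value `k`. Then `x` is a slot at which the scan for `k` had to end an idle stretch, so processor `k`
cannot be kept idle there. No job can then be moved from `x` to a later slot `s` of smaller volume:
each job running in `x` also runs in `s` or is due before `s` (`IsFeasible.vol_add_numDue_le`). So
volume plus number of past deadlines never falls below its value at `x`, and it is always at most `2
* n` (`sum_increases_le`). Processors beyond the number of jobs idle throughout
(`ScanProcessors.of_idle`), so at most `n` scans contribute their two exceptional rounds.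

The check is correct (`ValidSegs.check_val`) because feasible schedules, allotments of job volume to
segments, and flows saturating the source correspond to each other. A flow of value `P` sends at
most `P - L` through `γ`, so it saturates the edges that encode the lower bounds, and wrap-around
turns an allotment back into a schedule.

A round adds at most four segments, so all networks have `O(n)` nodes. The size of the flow table
forces `f` to dominate the square of the number of nodes, which absorbs all bookkeeping. Binary
search contributes the factor `log d`, and `pltr_spec` adds everything up. -/

namespace PowerDown

open Timed

/-! ## Rules for step-counted computations -/

namespace Timed

variable {α β : Type}

@[simp] theorem pure_val (a : α) : (pure a : Timed α).val = a := rfl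

@[simp] theorem pure_time (a : α) : (pure a : Timed α).time = 0 := rfl

@[simp] theorem bind_val (x : Timed α) (g : α → Timed β) : (x >>= g).val = (g x.val).val := rfl

@[simp] theorem bind_time (x : Timed α) (g : α → Timed β) :
    (x >>= g).time = x.time + (g x.val).time := rfl

@[simp] theorem tick_time (k : ℕ) : (tick k).time = k := rfl

theorem fold_val (body : β → α → Timed β) (b : β) (l : List α) :
    (fold body b l).val = l.foldl (fun b a => (body b a).val) b := by
  induction l generalizing b with
  | nil => simp [fold]
  | cons a l ih => simp [fold, ih]

theorem fold_time_le (body : β → α → Timed β) (b : β) (l : List α) (τ : ℕ)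
    (h : ∀ b, ∀ a ∈ l, (body b a).time ≤ τ) :
    (fold body b l).time ≤ l.length * (τ + 1) + 1 := by
  induction l generalizing b with
  | nil => simp [fold]
  | cons a l ih =>
    have h₁ := h b a (by simp)
    have h₂ := ih (body b a).val fun b' a' ha' => h b' a' (by simp [ha'])
    simp only [fold, bind_time, tick_time, List.length_cons]
    linarith

theorem foldl_add_eq_sum (f : α → ℕ) (l : List α) (b : ℕ) :
    l.foldl (fun x a => x + f a) b = b + (l.map f).sum := by
  induction l generalizing b with
  | nil => simp
  | cons a l ih => simp [ih, add_assoc]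

/-- Binary search finds the maximum of a downward closed, non-empty set. -/
theorem isGreatest_search (test : ℕ → Timed Bool) (a b : ℕ) (hab : a ≤ b)
    (ha : (test a).val = true)
    (h : ∀ x y, a ≤ x → x ≤ y → y ≤ b → (test y).val = true → (test x).val = true) :
    IsGreatest {s | a ≤ s ∧ s ≤ b ∧ (test s).val = true} (search test a b).val := by
  induction hk : b - a using Nat.strong_induction_on generalizing a b with
  | _ k ih =>
    rw [search]
    split_ifs with hlt
    · simp only [bind_val]
      split_ifs with ht
      · have := ih (b - (a + b + 1) / 2) (by omega) ((a + b + 1) / 2) b (by omega) ht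
          (fun x y hx => h x y (by omega)) rfl
        exact ⟨⟨by have := this.1.1; omega, this.1.2⟩, fun s hs => by
          by_cases hs' : (a + b + 1) / 2 ≤ s
          · exact this.2 ⟨hs', hs.2⟩
          · have := this.1.1; omega⟩
      · have := ih ((a + b + 1) / 2 - 1 - a) (by omega) a ((a + b + 1) / 2 - 1) (by omega) ha
          (fun x y hx hxy hy => h x y hx hxy (by omega)) rfl
        refine ⟨⟨this.1.1, by have := this.1.2.1; omega, this.1.2.2⟩, fun s hs => ?_⟩
        refine this.2 ⟨hs.1, ?_, hs.2.2⟩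
        by_contra hs'
        exact ht (h _ s (by omega) (by omega) hs.2.1 hs.2.2)
    · obtain rfl : a = b := by omega
      exact ⟨⟨le_rfl, le_rfl, ha⟩, fun s hs => hs.2.1⟩

/-- Either outcome of a probe halves the width of the candidate range, so a range of width below `2
^ e` needs at most `e` probes. -/
theorem search_time_le (test : ℕ → Timed Bool) (a b e τ : ℕ) (he : b - a < 2 ^ e)
    (h : ∀ x, (test x).time ≤ τ) : (search test a b).time ≤ e * (τ + 1) + 1 := by
  induction e generalizing a b with
  | zero =>
    rw [search, dif_neg (by omega)]
    simp
  | succ e ih =>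
    rw [search]
    split_ifs with hlt
    · have h₁ := h ((a + b + 1) / 2)
      rw [pow_succ] at he
      simp only [bind_time, tick_time]
      split_ifs
      · have := ih ((a + b + 1) / 2) b (by omega)
        linarith
      · have := ih a ((a + b + 1) / 2 - 1) (by omega)
        linarith
    · simp

end Timed

/-! ## Schedules and bounds -/

theorem Bounds.ext' {B B' : Bounds} (hl : ∀ s, B.lo s = B'.lo s) (hu : ∀ s, B.up s = B'.up s) :
    B = B' := by
  cases B; cases B'
  simp only [Bounds.mk.injEq]
  exact ⟨funext hl, funext hu⟩

theorem Bounds.setIdle_self (B : Bounds) (k t : ℕ) : B.setIdle k t t = B :=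
  Bounds.ext' (fun _ => rfl) fun s => if_neg (by omega)

theorem Bounds.setBusy_self (B : Bounds) (k t : ℕ) : B.setBusy k t t = B :=
  Bounds.ext' (fun s => if_neg (by omega)) fun _ => rfl

theorem Bounds.setIdle_setIdle (B : Bounds) (k : ℕ) {t t₁ t₂ : ℕ} (h₁ : t ≤ t₁) (h₂ : t₁ ≤ t₂) :
    (B.setIdle k t t₁).setIdle k t₁ t₂ = B.setIdle k t t₂ := by
  refine Bounds.ext' (fun _ => rfl) fun s => ?_
  simp only [Bounds.setIdle]
  split_ifs <;> omega

theorem Bounds.setBusy_setBusy (B : Bounds) (k : ℕ) {t t₁ t₂ : ℕ} (h₁ : t ≤ t₁) (h₂ : t₁ ≤ t₂) :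
    (B.setBusy k t t₁).setBusy k t₁ t₂ = B.setBusy k t t₂ := by
  refine Bounds.ext' (fun s => ?_) fun _ => rfl
  simp only [Bounds.setBusy]
  split_ifs <;> omega

namespace Instance

variable {n : ℕ} (I : Instance n)

/-- The jobs that run in slot `t`. -/
def running {m : ℕ} (σ : Schedule m n) (t : ℕ) : Finset (Fin n) :=
  Finset.univ.filter fun j => ∃ k, σ k t = some j

/-- The number of deadlines before `t`. -/
def numDue (t : ℕ) : ℕ := (Finset.univ.filter fun j => (I.job j).deadline < t).card

theorem numDue_le (t : ℕ) : I.numDue t ≤ n :=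
  (Finset.card_le_univ _).trans (by simp)

variable {I}

theorem mem_running {m : ℕ} {σ : Schedule m n} {t : ℕ} {j : Fin n} :
    j ∈ running σ t ↔ ∃ k, σ k t = some j := by
  simp [running]

/-- No job runs twice in a slot, so busy processors and running jobs are in bijection. This turns
volumes into cardinalities of sets of jobs, to which exchange arguments apply. -/
theorem IsFeasible.card_running {σ : Schedule I.m n} (h : I.IsFeasible σ) (t : ℕ) :
    (running σ t).card = σ.vol t := by
  symm
  refine Finset.card_bij' (t := running σ t)
    (fun k hk => (σ k t).get (by simpa using hk))
    (fun j hj => (mem_running.1 hj).choose) ?_ ?_ ?_ ?_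
  · intro k hk
    exact mem_running.2 ⟨k, by simp⟩
  · intro j hj
    have := (mem_running.1 hj).choose_spec
    simp [this]
  · intro k hk
    have := (mem_running.1 (mem_running.2 ⟨k, (Option.some_get (by simpa using hk)).symm⟩ :
      (σ k t).get (by simpa using hk) ∈ running σ t)).choose_spec
    exact h.no_parallel t _ _ _ this (by simp)
  · intro j hj
    have := (mem_running.1 hj).choose_spec
    simp [this]

theorem IsFeasible.vol_le {σ : Schedule I.m n} (h : I.IsFeasible σ) (t : ℕ) : σ.vol t ≤ n := by
  rw [← h.card_running]
  exact (Finset.card_le_univ _).trans (by simp)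

theorem deadline_le_d (j : Fin n) : (I.job j).deadline ≤ I.d :=
  Finset.le_sup (f := fun j => (I.job j).deadline) (Finset.mem_univ j)

theorem Respects.mono {σ : Schedule I.m n} {B B' : Bounds} (h : I.Respects σ B)
    (hB : ∀ t ≤ I.d, B'.lo t ≤ B.lo t ∧ B.up t ≤ B'.up t) : I.Respects σ B' := fun t ht =>
  ⟨(hB t ht).1.trans (h t ht).1, (h t ht).2.trans (hB t ht).2⟩

theorem FeasibleWith.mono {B B' : Bounds} (h : I.FeasibleWith B)
    (hB : ∀ t ≤ I.d, B'.lo t ≤ B.lo t ∧ B.up t ≤ B'.up t) : I.FeasibleWith B' :=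
  let ⟨σ, hσ, hr⟩ := h
  ⟨σ, hσ, hr.mono hB⟩

/-- A single slot can be kept idle or be kept busy. -/
theorem FeasibleWith.idle_or_busy {B : Bounds} (h : I.FeasibleWith B) (k s : ℕ) :
    I.FeasibleWith (B.setIdle k s (s + 1)) ∨ I.FeasibleWith (B.setBusy k s (s + 1)) := by
  obtain ⟨σ, hσ, hr⟩ := h
  by_cases hk : σ.vol s < k
  · refine Or.inl ⟨σ, hσ, fun t ht => ⟨(hr t ht).1, ?_⟩⟩
    simp only [Bounds.setIdle]
    split_ifs with h
    · obtain rfl : t = s := by omega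
      omega
    · exact (hr t ht).2
  · refine Or.inr ⟨σ, hσ, fun t ht => ⟨?_, (hr t ht).2⟩⟩
    simp only [Bounds.setBusy]
    split_ifs with h
    · obtain rfl : t = s := by omega
      have := (hr t ht).1
      omega
    · exact (hr t ht).1

/-- Moving a job from slot `x` to slot `s`. -/
theorem IsFeasible.move {σ : Schedule I.m n} (h : I.IsFeasible σ) {x s : ℕ} (hx : x ≤ I.d)
    (hxs : x ≠ s) (hvol : σ.vol s < σ.vol x) {j : Fin n} (hj : j ∈ running σ x)
    (hjs : j ∉ running σ s) (hr : (I.job j).release ≤ s) (hd : s ≤ (I.job j).deadline) :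
    ∃ σ' : Schedule I.m n, I.IsFeasible σ' ∧ σ'.vol x + 1 = σ.vol x ∧ σ'.vol s = σ.vol s + 1 ∧
      ∀ t, t ≠ x → t ≠ s → σ'.vol t = σ.vol t := by
  obtain ⟨k₀, hk₀⟩ := mem_running.1 hj
  have hjs' : ∀ k, σ k s ≠ some j := fun k hk => hjs (mem_running.2 ⟨k, hk⟩)
  -- A free processor in slot `s`: otherwise the volume there would be `I.m`, which is not below the
  -- volume at `x`.
  obtain ⟨k₁, hk₁⟩ : ∃ k₁, σ k₁ s = none := by
    by_contra! hne
    have h₁ : σ.vol s = I.m := by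
      unfold Schedule.vol
      rw [Finset.filter_true_of_mem (fun k _ => Option.isSome_iff_ne_none.2 (hne k))]
      simp
    have h₂ : σ.vol x ≤ I.m := (Finset.card_le_univ _).trans (by simp)
    omega
  let σ' : Schedule I.m n := fun k t =>
    if t = x ∧ k = k₀ then none else if t = s ∧ k = k₁ then some j else σ k t
  have hσ' : ∀ k t, σ' k t =
    if t = x ∧ k = k₀ then none else if t = s ∧ k = k₁ then some j else σ k t := fun _ _ => rfl
  have hcases : ∀ k t i, σ' k t = some i ↔
      (t = s ∧ k = k₁ ∧ i = j) ∨ (σ k t = some i ∧ ¬ (t = x ∧ k = k₀)) := by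
    intro k t i
    rw [hσ']
    split_ifs with h₁ h₂
    · simp only [false_iff]
      rintro (⟨h₃, -⟩ | ⟨-, h₃⟩)
      · exact hxs (h₁.1.symm.trans h₃)
      · exact h₃ h₁
    · simp only [Option.some.injEq]
      constructor
      · rintro rfl
        exact Or.inl ⟨h₂.1, h₂.2, rfl⟩
      · rintro (⟨-, -, h₃⟩ | ⟨h₃, -⟩)
        · exact h₃.symm
        · rw [h₂.1, h₂.2, hk₁] at h₃
          cases h₃
    · constructor
      · exact fun h₃ => Or.inr ⟨h₃, h₁⟩
      · rintro (⟨h₃, h₄, -⟩ | ⟨h₃, -⟩)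
        · exact absurd ⟨h₃, h₄⟩ h₂
        · exact h₃
  have hf : I.IsFeasible σ' := by
    refine ⟨fun k t i hi => ?_, fun t i k k' hk hk' => ?_, fun i => ?_⟩
    · rcases (hcases k t i).1 hi with ⟨rfl, -, rfl⟩ | ⟨h₃, -⟩
      · exact ⟨hr, hd⟩
      · exact h.window k t i h₃
    · rcases (hcases k t i).1 hk with ⟨rfl, rfl, rfl⟩ | ⟨h₃, -⟩ <;>
        rcases (hcases k' t i).1 hk' with ⟨h₄, h₅, h₆⟩ | ⟨h₄, -⟩
      · exact h₅.symm
      · exact absurd h₄ (hjs' k')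
      · rw [h₄, h₆] at h₃
        exact absurd h₃ (hjs' k)
      · exact h.no_parallel t i k k' h₃ h₄
    · rw [← h.volume i]
      by_cases hij : i = j
      · subst hij
        have hx' : x ∈ (Finset.range (I.d + 1)).filter fun t => ∃ k, σ k t = some i := by
          simp only [Finset.mem_filter, Finset.mem_range]
          exact ⟨by omega, k₀, hk₀⟩
        have : ((Finset.range (I.d + 1)).filter fun t => ∃ k, σ' k t = some i) =
            insert s (((Finset.range (I.d + 1)).filter fun t => ∃ k, σ k t = some i).erase x) := by
          ext t
          simp only [Finset.mem_filter, Finset.mem_range, Finset.mem_insert, Finset.mem_erase]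
          constructor
          · rintro ⟨ht, k, hk⟩
            rcases (hcases k t i).1 hk with ⟨h₃, -, -⟩ | ⟨h₃, h₄⟩
            · exact Or.inl h₃
            · refine Or.inr ⟨?_, ht, k, h₃⟩
              rintro rfl
              exact h₄ ⟨rfl, h.no_parallel t i k k₀ h₃ hk₀⟩
          · rintro (rfl | ⟨h₃, ht, k, hk⟩)
            · refine ⟨by have := I.deadline_le_d i; omega, k₁, ?_⟩
              exact (hcases k₁ t i).2 (Or.inl ⟨rfl, rfl, rfl⟩)
            · exact ⟨ht, k, (hcases k t i).2 (Or.inr ⟨hk, fun h₄ => h₃ h₄.1⟩)⟩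
        rw [this, Finset.card_insert_of_notMem, Finset.card_erase_add_one hx']
        simp only [Finset.mem_erase, Finset.mem_filter, not_and]
        rintro - - ⟨k, hk⟩
        exact hjs' k hk
      · congr 1
        ext t
        simp only [Finset.mem_filter, Finset.mem_range, and_congr_right_iff]
        intro _
        refine exists_congr fun k => ?_
        rw [hcases]
        constructor
        · rintro (⟨-, -, h₃⟩ | ⟨h₃, -⟩)
          · exact absurd h₃ hij
          · exact h₃
        · intro h₃
          refine Or.inr ⟨h₃, ?_⟩
          rintro ⟨rfl, rfl⟩
          rw [hk₀] at h₃
          exact hij (Option.some.inj h₃).symm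
  have hx₀ : k₀ ∈ Finset.univ.filter fun k => (σ k x).isSome := by simp [hk₀]
  refine ⟨σ', hf, ?_, ?_, ?_⟩
  · unfold Schedule.vol
    have : (Finset.univ.filter fun k => (σ' k x).isSome) =
        (Finset.univ.filter fun k => (σ k x).isSome).erase k₀ := by
      ext k
      simp only [Finset.mem_filter, Finset.mem_univ, true_and, Finset.mem_erase, hσ']
      by_cases hk : k = k₀ <;> simp [hk, hxs]
    rw [this, Finset.card_erase_add_one hx₀]
  · unfold Schedule.vol
    have : (Finset.univ.filter fun k => (σ' k s).isSome) =
        insert k₁ (Finset.univ.filter fun k => (σ k s).isSome) := by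
      ext k
      simp only [Finset.mem_filter, Finset.mem_univ, true_and, Finset.mem_insert, hσ']
      by_cases hk : k = k₁ <;> simp [hk, hxs.symm]
    rw [this, Finset.card_insert_of_notMem (by simp [hk₁])]
  · intro t htx hts
    unfold Schedule.vol
    congr 1
    ext k
    simp [hσ', htx, hts]

/-- If processor `σ.vol x` cannot be kept idle in slot `x`, then almost all jobs that run in slot `x`
and are not due before a later slot `s` of smaller volume run in slot `s`, too. -/
theorem IsFeasible.vol_add_numDue_le {σ : Schedule I.m n} (h : I.IsFeasible σ) {B : Bounds}
    (hr : I.Respects σ B) {x s : ℕ} (hx : x ≤ I.d) (hxs : x < s) (hs : s ≤ I.d)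
    (hlo : B.lo x < σ.vol x) (hup : σ.vol x ≤ B.up s)
    (hB : ¬ I.FeasibleWith (B.setIdle (σ.vol x) x (x + 1))) :
    σ.vol x + I.numDue x ≤ σ.vol s + I.numDue s := by
  by_cases hvol : σ.vol s < σ.vol x
  -- A job that runs in `x`, does not run in `s` and is not due before `s` could be moved to `s`,
  -- contradicting `hB`. The lower bound has slack at `x` by `hlo`, the upper bound has slack at `s`
  -- by `hvol` and `hup`.
  · have hsub : running σ x ∪ (Finset.univ.filter fun j => (I.job j).deadline < x) ⊆
        running σ s ∪ (Finset.univ.filter fun j => (I.job j).deadline < s) := by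
      intro j hj
      simp only [Finset.mem_union, Finset.mem_filter, Finset.mem_univ, true_and] at hj ⊢
      rcases hj with hj | hj
      · by_contra! hcon
        obtain ⟨k, hk⟩ := mem_running.1 hj
        have hw := h.window k x j hk
        obtain ⟨σ', hσ', h₁, h₂, h₃⟩ := h.move hx hxs.ne hvol hj hcon.1 (by omega) hcon.2
        refine hB ⟨σ', hσ', fun t ht => ?_⟩
        have hrt := hr t ht
        by_cases htx : t = x
        · subst htx
          simp only [Bounds.setIdle, le_refl, Nat.lt_succ_self, and_self, if_true]
          omega
        · have hup' : (B.setIdle (σ.vol x) x (x + 1)).up t = B.up t := if_neg (by omega)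
          rw [hup']
          change B.lo t ≤ _ ∧ _
          by_cases hts : t = s
          · subst hts
            omega
          · rw [h₃ t htx hts]
            exact hrt
      · exact Or.inr (hj.trans hxs)
    have hdisj : Disjoint (running σ x)
        (Finset.univ.filter fun j => (I.job j).deadline < x) := by
      rw [Finset.disjoint_left]
      intro j hj hj'
      obtain ⟨k, hk⟩ := mem_running.1 hj
      have := (h.window k x j hk).2
      simp only [Finset.mem_filter, Finset.mem_univ, true_and] at hj'
      omega
    have hcard := (Finset.card_le_card hsub).trans (Finset.card_union_le _ _)
    rwa [Finset.card_union_of_disjoint hdisj, h.card_running, h.card_running] at hcard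
  · have : I.numDue x ≤ I.numDue s := Finset.card_le_card fun j hj => by
      simp only [Finset.mem_filter, Finset.mem_univ, true_and] at hj ⊢
      omega
    omega

/-! ## The number of rounds -/

variable (I)

/-- The `while`-loop for processor `k`, together with the number of its rounds. -/
inductive CountedScan (k : ℕ) : ℕ → ℕ → Bounds → Bounds → Prop
  | done (t : ℕ) (B : Bounds) : I.d < t → CountedScan k 0 t B B
  | step (R t t₁ t₂ : ℕ) (B B' : Bounds) : t ≤ I.d →
      I.IsKeepIdle B k t t₁ →
      I.IsKeepBusy (B.setIdle k t t₁) k t₁ t₂ →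
      CountedScan k R t₂ ((B.setIdle k t t₁).setBusy k t₁ t₂) B' →
      CountedScan k (R + 1) t B B'

variable {I}

/-- Since the idle stretch is maximal, slot `t₁` cannot be kept idle as well, so it can be kept
busy. Thus every round inside the horizon makes progress. -/
theorem IsKeepBusy.lt_of_isKeepIdle {B : Bounds} {k t t₁ t₂ : ℕ}
    (h₁ : I.IsKeepIdle B k t t₁) (h₂ : I.IsKeepBusy (B.setIdle k t t₁) k t₁ t₂) (hd : t₁ ≤ I.d) :
    t₁ < t₂ := by
  rcases h₁.1.2.2.idle_or_busy k t₁ with h | h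
  · rw [Bounds.setIdle_setIdle _ _ h₁.1.1 (Nat.le_succ _)] at h
    have := h₁.2 ⟨h₁.1.1.trans (Nat.le_succ _), by omega, h⟩
    omega
  · exact h₂.2 ⟨Nat.le_succ _, by omega, h⟩

/-- The dual argument: a busy stretch that ends inside the horizon is followed by a nonempty idle
stretch. -/
theorem IsKeepBusy.feasibleWith_setIdle {B : Bounds} {k t t' : ℕ} (h : I.IsKeepBusy B k t t')
    (hd : t' ≤ I.d) : I.FeasibleWith ((B.setBusy k t t').setIdle k t' (t' + 1)) := by
  rcases h.1.2.2.idle_or_busy k t' with h' | h'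
  · exact h'
  · rw [Bounds.setBusy_setBusy _ _ h.1.1 (Nat.le_succ _)] at h'
    have := h.2 ⟨h.1.1.trans (Nat.le_succ _), by omega, h'⟩
    omega

namespace CountedScan

variable {k R t : ℕ} {B B' : Bounds}

theorem scanProcessor (h : I.CountedScan k R t B B') : I.ScanProcessor k t B B' := by
  induction h with
  | done t B ht => exact .done t B ht
  | step R t t₁ t₂ B B' ht h₁ h₂ _ ih => exact .step t t₁ t₂ B B' ht h₁ h₂ ih

theorem feasibleWith (h : I.CountedScan k R t B B') (hB : I.FeasibleWith B) :
    I.FeasibleWith B' := by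
  induction h with
  | done t B ht => exact hB
  | step R t t₁ t₂ B B' ht h₁ h₂ _ ih => exact ih h₂.1.2.2

theorem lo_le (h : I.CountedScan k R t B B') (s : ℕ) : B.lo s ≤ B'.lo s := by
  induction h with
  | done t B ht => exact le_rfl
  | step R t t₁ t₂ B B' ht h₁ h₂ _ ih =>
    refine le_trans ?_ ih
    simp only [Bounds.setBusy, Bounds.setIdle]
    split_ifs <;> omega

/-- Maintains the invariant that a lower bound is either still zero or exceeds the number of the
processor scanned next. -/
theorem lo_eq_or (h : I.CountedScan k R t B B') (s : ℕ) : B'.lo s = B.lo s ∨ k ≤ B'.lo s := by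
  induction h with
  | done t B ht => exact Or.inl rfl
  | step R t t₁ t₂ B B' ht h₁ h₂ h₃ ih =>
    rcases ih with ih | ih
    · rw [ih]
      simp only [Bounds.setBusy, Bounds.setIdle]
      split_ifs <;> omega
    · exact Or.inr ih

/-- The only value written is `k - 1`, so an upper bound of at least `k - 1` can only decrease and
stays at least `k - 1`, as the remaining scans require. -/
theorem up_le (h : I.CountedScan k R t B B') (s : ℕ) (hB : k - 1 ≤ B.up s) :
    B'.up s ≤ B.up s ∧ k - 1 ≤ B'.up s := by
  induction h with
  | done t B ht => exact ⟨le_rfl, hB⟩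
  | step R t t₁ t₂ B B' ht h₁ h₂ _ ih =>
    have : k - 1 ≤ (B.setIdle k t t₁).up s ∧ (B.setIdle k t t₁).up s ≤ B.up s := by
      simp only [Bounds.setIdle]
      split_ifs <;> omega
    have := ih (by exact this.1)
    simp only [Bounds.setBusy] at this
    omega

/-- Allows a single schedule, chosen for the final bounds, to be used at every intermediate moment.
-/
theorem respects (h : I.CountedScan k R t B B') (hB : ∀ s ≤ I.d, k - 1 ≤ B.up s)
    {σ : Schedule I.m n} (hr : I.Respects σ B') : I.Respects σ B :=
  hr.mono fun s hs => ⟨h.lo_le s, (h.up_le s (hB s hs)).1⟩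

theorem pred_le_up_setIdle {t t₁ s : ℕ} (hB : k - 1 ≤ B.up s) :
    k - 1 ≤ (B.setIdle k t t₁).up s := by
  simp only [Bounds.setIdle]
  split_ifs <;> omega

/-- The volume of a schedule that respects the bounds after a round. -/
theorem vol_of_round {t₁ t₂ : ℕ} (ht₁ : t₁ ≤ I.d + 1) (hk : 1 ≤ k)
    (h : I.CountedScan k R t₂ ((B.setIdle k t t₁).setBusy k t₁ t₂) B')
    (hB : ∀ s ≤ I.d, k - 1 ≤ B.up s) {σ : Schedule I.m n} (hr : I.Respects σ B') :
    (∀ s, t ≤ s → s < t₁ → σ.vol s < k) ∧ ∀ s, t₁ ≤ s → s < t₂ → s ≤ I.d → k ≤ σ.vol s := by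
  have hr' := h.respects (fun s hs => pred_le_up_setIdle (hB s hs)) hr
  refine ⟨fun s h₁ h₂ => ?_, fun s h₁ h₂ h₃ => ?_⟩
  · have := (hr' s (by omega)).2
    simp only [Bounds.setBusy, Bounds.setIdle, if_pos (And.intro h₁ h₂)] at this
    omega
  · have := (hr' s h₃).1
    simp only [Bounds.setBusy, if_pos (And.intro h₁ h₂)] at this
    omega

/-- After an increase to the volume `k`, the sum of the volume and of the number of past deadlines
never falls below its value there. -/
theorem vol_add_numDue_le (h : I.CountedScan k R t B B') (hk : 1 ≤ k)
    (hB : ∀ s ≤ I.d, k - 1 ≤ B.up s) (hB' : ∀ s, t ≤ s → s ≤ I.d → k ≤ B.up s)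
    {σ : Schedule I.m n} (hσ : I.IsFeasible σ) (hr : I.Respects σ B')
    {x s : ℕ} (hx : t < x) (hlo : B.lo x < k) (hpred : σ.vol (x - 1) < k) (hvol : σ.vol x = k)
    (hxs : x < s) (hs : s ≤ I.d) : σ.vol x + I.numDue x ≤ σ.vol s + I.numDue s := by
  induction h with
  | done t B ht => omega
  | step R t t₁ t₂ B B' ht h₁ h₂ h₃ ih =>
    have hround := vol_of_round h₁.1.2.1 hk h₃ hB hr
    have hxd : x ≤ I.d := by omega
    have htt := h₁.1.1
    have htt' := h₂.1.1
    -- The slot `x` is not in the idle stretch, where the volume is below `k`. It is not in `(t₁,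
    -- t₂]` either, since `x - 1` would then lie in the busy stretch. So it is `t₁` or belongs to a
    -- later round.
    rcases lt_trichotomy x t₁ with hlt | rfl | hgt
    · have := hround.1 x hx.le hlt
      omega
    · have hr₁ := (h₃.respects (fun s hs => pred_le_up_setIdle (hB s hs)) hr).mono
        (B' := B.setIdle k t x) fun s _ => ⟨by
          simp only [Bounds.setBusy]
          split_ifs <;> omega, le_rfl⟩
      refine hσ.vol_add_numDue_le hr₁ hxd hxs hs (by rw [hvol]; exact hlo) ?_ ?_
      · rw [hvol]
        simp only [Bounds.setIdle]
        rw [if_neg (by omega)]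
        exact hB' s (by omega) hs
      -- The idle stretch ended at `x`, so by maximality it cannot be prolonged by this slot.
      · rw [hvol, Bounds.setIdle_setIdle _ _ htt (Nat.le_succ _)]
        intro hf
        have := h₁.2 ⟨by omega, by omega, hf⟩
        omega
    · by_cases hx₂ : x ≤ t₂
      · have := hround.2 (x - 1) (by omega) (by omega) (by omega)
        omega
      · refine ih (fun s hs => pred_le_up_setIdle (hB s hs)) (fun s h₄ h₅ => ?_) hr (by omega) ?_
        · simp only [Bounds.setBusy, Bounds.setIdle]
          rw [if_neg (by omega)]
          exact hB' s (by omega) h₅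
        · simp only [Bounds.setBusy, Bounds.setIdle]
          rw [if_neg (by omega)]
          exact hlo

/-- The slots after `t` in which the volume increases from below `k` to at least `k`. -/
def increases {m : ℕ} (σ : Schedule m n) (k t d : ℕ) : Finset ℕ :=
  (Finset.Ioc t d).filter fun x => σ.vol (x - 1) < k ∧ k ≤ σ.vol x

/-- If slot `t` can be kept idle, the first idle stretch is nonempty. The start `t₁` of the busy
stretch, if inside the horizon, is then an increase, distinct from those after `t₂`. By
`feasibleWith_setIdle` this applies to all rounds but the first. The two exceptional rounds are the
first, whose idle stretch may be empty, and the last, whose busy stretch may be. -/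
theorem rounds_le_of_setIdle (h : I.CountedScan k R t B B') (hk : 1 ≤ k)
    (hB : ∀ s ≤ I.d, k - 1 ≤ B.up s) {σ : Schedule I.m n} (hr : I.Respects σ B') :
    R ≤ 2 + (increases σ k t I.d).card ∧
      ((t ≤ I.d → I.FeasibleWith (B.setIdle k t (t + 1))) →
        R ≤ 1 + (increases σ k t I.d).card) := by
  induction h with
  | done t B ht => simp
  | step R t t₁ t₂ B B' ht h₁ h₂ h₃ ih =>
    have hround := vol_of_round h₁.1.2.1 hk h₃ hB hr
    have htt := h₁.1.1
    have htt' := h₂.1.1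
    have ih' := (ih (fun s hs => pred_le_up_setIdle (hB s hs)) hr).2 h₂.feasibleWith_setIdle
    have hsub : increases σ k t₂ I.d ⊆ increases σ k t I.d := by
      intro x hx
      simp only [increases, Finset.mem_filter, Finset.mem_Ioc] at hx ⊢
      exact ⟨⟨by omega, hx.1.2⟩, hx.2⟩
    have hcard := Finset.card_le_card hsub
    refine ⟨by omega, fun hf => ?_⟩
    have hlt : t < t₁ := h₁.2 ⟨Nat.le_succ _, by omega, hf ht⟩
    by_cases hd : t₁ ≤ I.d
    · have hlt' := IsKeepBusy.lt_of_isKeepIdle h₁ h₂ hd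
      have : insert t₁ (increases σ k t₂ I.d) ⊆ increases σ k t I.d := by
        refine Finset.insert_subset ?_ hsub
        simp only [increases, Finset.mem_filter, Finset.mem_Ioc]
        exact ⟨⟨hlt, hd⟩, hround.1 _ (by omega) (by omega), hround.2 _ le_rfl hlt' hd⟩
      have := Finset.card_le_card this
      rw [Finset.card_insert_of_notMem (by simp [increases]; omega)] at this
      omega
    -- The idle stretch reached the end of the horizon, so no round follows.
    · cases h₃ with
      | done => omega
      | step => omega

theorem rounds_le (h : I.CountedScan k R t B B') (hk : 1 ≤ k)
    (hB : ∀ s ≤ I.d, k - 1 ≤ B.up s) {σ : Schedule I.m n} (hr : I.Respects σ B') :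
    R ≤ 2 + (increases σ k t I.d).card :=
  (h.rounds_le_of_setIdle hk hB hr).1

end CountedScan

variable (I)

/-- The `for`-loop over the processors `k, k - 1, …, 1`, together with the total number of rounds. -/
inductive CountedScans : ℕ → ℕ → Bounds → Bounds → Prop
  | zero (B : Bounds) : CountedScans 0 0 B B
  | succ (k R R' : ℕ) (B B' B'' : Bounds) : I.CountedScan (k + 1) R 0 B B' →
      CountedScans k R' B' B'' → CountedScans (k + 1) (R + R') B B''

variable {I}

/-! ### All processors together: the sum of the rounds -/

namespace CountedScans

open CountedScan

variable {k R : ℕ} {B B' : Bounds}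

theorem scanProcessors (h : I.CountedScans k R B B') : I.ScanProcessors k B B' := by
  induction h with
  | zero B => exact .zero B
  | succ k R R' B B' B'' h _ ih => exact .succ k B B' B'' h.scanProcessor ih

theorem respects (h : I.CountedScans k R B B') (hB : ∀ s ≤ I.d, k ≤ B.up s)
    {σ : Schedule I.m n} (hr : I.Respects σ B') : I.Respects σ B := by
  induction h with
  | zero B => exact hr
  | succ k R R' B B' B'' h _ ih =>
    refine h.respects (fun s hs => ?_) (ih (fun s hs => ?_) hr)
    · have := hB s hs; omega
    · exact (h.up_le s (by have := hB s hs; omega)).2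

theorem rounds_le (h : I.CountedScans k R B B') (hB : ∀ s ≤ I.d, k ≤ B.up s)
    {σ : Schedule I.m n} (hr : I.Respects σ B') :
    R ≤ 2 * k + ∑ i ∈ Finset.range k, (increases σ (i + 1) 0 I.d).card := by
  induction h with
  | zero B => simp
  | succ k R R' B B' B'' h h' ih =>
    have hup : ∀ s ≤ I.d, k ≤ B'.up s := fun s hs =>
      (h.up_le s (by have := hB s hs; omega)).2
    have h₁ := ih hup hr
    have h₂ := h.rounds_le (by omega) (fun s hs => by have := hB s hs; omega)
      (h'.respects hup hr)
    rw [Finset.sum_range_succ]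
    omega

/-- An increase at `x` is handled in the scan for processor number `σ.vol x`. When that scan starts,
the lower bound at `x` is at most `σ.vol x`, whereas a nonzero one would exceed this number. So it
is zero, which leaves room for removing a job from `x`. -/
theorem vol_add_numDue_le (h : I.CountedScans k R B B') (hB : ∀ s ≤ I.d, k ≤ B.up s)
    (hlo : ∀ s ≤ I.d, B.lo s = 0 ∨ k < B.lo s)
    {σ : Schedule I.m n} (hσ : I.IsFeasible σ) (hr : I.Respects σ B') {x s : ℕ} (hx : 1 ≤ x)
    (hvol : σ.vol (x - 1) < σ.vol x) (hle : σ.vol x ≤ k) (hxs : x < s) (hs : s ≤ I.d) :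
    σ.vol x + I.numDue x ≤ σ.vol s + I.numDue s := by
  induction h with
  | zero B => omega
  | succ k R R' B B' B'' h h' ih =>
    have hup : ∀ s ≤ I.d, k ≤ B'.up s := fun s hs =>
      (h.up_le s (by have := hB s hs; omega)).2
    by_cases hk : σ.vol x = k + 1
    · have hr' := h'.respects hup hr
      have h₁ := (h.respects (fun s hs => by have := hB s hs; omega) hr' x (by omega)).1
      have h₂ := hlo x (by omega)
      exact h.vol_add_numDue_le (by omega) (fun s hs => by have := hB s hs; omega)
        (fun s _ hs => hB s hs) hσ hr' (by omega) (by omega) (by omega) hk hxs hs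
    · refine ih hup (fun s hs => ?_) hr (by omega)
      have h₁ := hlo s hs
      have h₂ := h.lo_eq_or s
      omega

end CountedScans

/-- The sum of all increases of `v`, given that `v + D` never falls below its value at an earlier
increase of `v`. -/
theorem sum_increases_le {v D : ℕ → ℕ} {d N : ℕ} (hv : ∀ x ≤ d, v x ≤ N)
    (hD : ∀ x ≤ d, D x ≤ N) (hmono : Monotone D)
    (h : ∀ x s, 1 ≤ x → v (x - 1) < v x → x < s → s ≤ d → v x + D x ≤ v s + D s) :
    ∑ x ∈ Finset.Ioc 0 d, (v x - v (x - 1)) ≤ 2 * N := by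
  -- Subtraction is truncated, so only increases count. The witness `x` is the latest increase. When
  -- the next one occurs at `e + 1`, the sum grows by `v (e + 1) - v e`, and `v x + D x ≤ v e + D e`
  -- cancels the term `v e`.
  have key : ∀ e ≤ d, ∑ x ∈ Finset.Ioc 0 e, (v x - v (x - 1)) = 0 ∨
      ∃ x, 1 ≤ x ∧ x ≤ e ∧ v (x - 1) < v x ∧
        ∑ x ∈ Finset.Ioc 0 e, (v x - v (x - 1)) ≤ v x + D x := by
    intro e he
    induction e with
    | zero => simp
    | succ e ih =>
      rw [Finset.sum_Ioc_succ_top (Nat.zero_le e), Nat.add_sub_cancel]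
      have ih := ih (by omega)
      by_cases hlt : v e < v (e + 1)
      · refine Or.inr ⟨e + 1, by omega, le_rfl, hlt, ?_⟩
        rcases ih with h₀ | ⟨x, hx₁, hx₂, hx₃, hx₄⟩
        · omega
        · have h₁ : v x + D x ≤ v e + D e := by
            rcases hx₂.lt_or_eq with hxe | rfl
            · exact h x e hx₁ hx₃ hxe (by omega)
            · exact le_rfl
          have h₂ := hmono (Nat.le_succ e)
          simp only [Nat.succ_eq_add_one] at h₂
          omega
      · rcases ih with h₀ | ⟨x, hx₁, hx₂, hx₃, hx₄⟩
        · left; omega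
        · exact Or.inr ⟨x, hx₁, by omega, hx₃, by omega⟩
  rcases key d le_rfl with h₀ | ⟨x, hx₁, hx₂, hx₃, hx₄⟩
  · omega
  · have h₁ := hv x hx₂
    have h₂ := hD x hx₂
    omega

-- Double counting: slot `x` is an increase for processor number `i + 1` exactly if `σ.vol (x - 1) ≤
-- i < σ.vol x`.
open CountedScan in
theorem sum_card_increases_le {m : ℕ} (σ : Schedule m n) (k d : ℕ) :
    ∑ i ∈ Finset.range k, (increases σ (i + 1) 0 d).card ≤
      ∑ x ∈ Finset.Ioc 0 d, (σ.vol x - σ.vol (x - 1)) := by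
  simp only [increases, Finset.card_filter]
  rw [Finset.sum_comm]
  refine Finset.sum_le_sum fun x _ => ?_
  rw [← Finset.card_filter]
  calc _ ≤ (Finset.Ico (σ.vol (x - 1)) (σ.vol x)).card := Finset.card_le_card fun i hi => by
        simp only [Finset.mem_filter, Finset.mem_range, Finset.mem_Ico] at hi ⊢
        omega
    _ = _ := by simp

/-- The total number of rounds is linear in the number of jobs. -/
theorem CountedScans.rounds_le_mul {k R : ℕ} {B B' : Bounds} (h : I.CountedScans k R B B')
    (hB : ∀ s ≤ I.d, B.up s = k) (hlo : ∀ s ≤ I.d, B.lo s = 0) (hk : k ≤ n)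
    (hf : I.FeasibleWith B') : R ≤ 4 * n := by
  obtain ⟨σ, hσ, hr⟩ := hf
  have h₁ := h.rounds_le (fun s hs => (hB s hs).ge) hr
  have h₂ := sum_card_increases_le σ k I.d
  have h₃ : ∑ x ∈ Finset.Ioc 0 I.d, (σ.vol x - σ.vol (x - 1)) ≤ 2 * n := by
    refine sum_increases_le (D := I.numDue) (fun x _ => hσ.vol_le x) (fun x _ => I.numDue_le x)
      (fun x y hxy => Finset.card_le_card fun j hj => ?_) fun x s hx hvol hxs hs => ?_
    · simp only [Finset.mem_filter, Finset.mem_univ, true_and] at hj ⊢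
      omega
    · refine h.vol_add_numDue_le (fun s hs => (hB s hs).ge) (fun s hs => Or.inl (hlo s hs)) hσ hr
        hx hvol ?_ hxs hs
      have := (h.respects (fun s hs => (hB s hs).ge) hr x (by omega)).2
      rwa [hB x (by omega)] at this
  -- At most `2 * k ≤ 2 * n` exceptional rounds, and at most `2 * n` rounds that are charged to
  -- increases.
  omega

theorem CountedScans.feasibleWith {k R : ℕ} {B B' : Bounds} (h : I.CountedScans k R B B')
    (hB : I.FeasibleWith B) : I.FeasibleWith B' := by
  induction h with
  | zero B => exact hB
  | succ k R R' B B' B'' h _ ih => exact ih (h.feasibleWith hB)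

/-- Processors beyond the number of jobs are kept idle. -/
theorem ScanProcessors.of_idle (hI : I.Feasible) {k : ℕ} (hk : n ≤ k) (e : ℕ) {B : Bounds}
    (hlo : ∀ s, B.lo s = 0) (hup : ∀ s ≤ I.d, B.up s = k + e) :
    ∃ B₀ : Bounds, (∀ s, B₀.lo s = 0) ∧ (∀ s ≤ I.d, B₀.up s = k) ∧
      ∀ B', I.ScanProcessors k B₀ B' → I.ScanProcessors (k + e) B B' := by
  induction e generalizing B with
  | zero => exact ⟨B, hlo, hup, fun _ h => h⟩
  | succ e ih =>
    obtain ⟨σ, hσ⟩ := hI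
    have hfeas : I.FeasibleWith (B.setIdle (k + e + 1) 0 (I.d + 1)) := by
      refine ⟨σ, hσ, fun t ht => ⟨?_, ?_⟩⟩
      · simp [Bounds.setIdle, hlo]
      · have := hσ.vol_le t
        simp only [Bounds.setIdle]
        rw [if_pos (by omega)]
        omega
    obtain ⟨B₀, h₁, h₂, h₃⟩ := ih (B := B.setIdle (k + e + 1) 0 (I.d + 1)) hlo (fun s hs => by
      simp only [Bounds.setIdle]
      rw [if_pos (by omega)]
      omega)
    refine ⟨B₀, h₁, h₂, fun B' hB' => ?_⟩
    -- One round suffices: the idle stretch covers the whole horizon and the busy stretch `[d + 1, d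
    -- + 1)` is empty.
    refine .succ (k + e) B _ B' (.step 0 (I.d + 1) (I.d + 1) B _ (Nat.zero_le _)
      ⟨⟨by omega, le_rfl, hfeas⟩, fun s hs => hs.2.1⟩
      ⟨⟨le_rfl, le_rfl, ?_⟩, fun s hs => hs.2.1⟩ (.done _ _ (by omega))) ?_
    · rwa [Bounds.setBusy_self]
    · rw [Bounds.setBusy_self]
      exact h₃ B' hB'

end Instance

/-! ## Lists of segments -/

/-- The segments are non-empty, adjacent, and range from `a` to `b`. -/
def Tiles : ℕ → ℕ → List Seg → Prop
  | a, b, [] => a = b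
  | a, b, s :: l => s.start = a ∧ a < s.finish ∧ Tiles s.finish b l

/-- The segment stores the bounds `B`. -/
def Seg.Stores (s : Seg) (B : Bounds) : Prop :=
  ∀ t, s.start ≤ t → t < s.finish → B.lo t = s.lo ∧ B.up t = s.up

/-- No segment has `x` in its interior. -/
def CutAt (x : ℕ) (segs : List Seg) : Prop := ∀ s ∈ segs, ¬ (s.start < x ∧ x < s.finish)

namespace Tiles

variable {a b : ℕ} {segs : List Seg}

theorem le (h : Tiles a b segs) : a ≤ b := by
  induction segs generalizing a with
  | nil => exact Eq.le h
  | cons s l ih =>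
    have := ih h.2.2
    have := h.2.1
    omega

theorem of_mem (h : Tiles a b segs) {s : Seg} (hs : s ∈ segs) :
    a ≤ s.start ∧ s.start < s.finish ∧ s.finish ≤ b := by
  induction segs generalizing a with
  | nil => cases hs
  | cons s' l ih =>
    obtain ⟨h₁, h₂, h₃⟩ := h
    rcases List.mem_cons.1 hs with rfl | hs
    · exact ⟨h₁.ge, by omega, h₃.le⟩
    · have := ih h₃ hs
      omega

theorem pairwise (h : Tiles a b segs) : segs.Pairwise fun s s' => s.finish ≤ s'.start := by
  induction segs generalizing a with
  | nil => exact List.Pairwise.nil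
  | cons s l ih => exact List.Pairwise.cons (fun s' hs' => (h.2.2.of_mem hs').1) (ih h.2.2)

theorem exists_mem (h : Tiles a b segs) {t : ℕ} (h₁ : a ≤ t) (h₂ : t < b) :
    ∃ s ∈ segs, s.start ≤ t ∧ t < s.finish := by
  induction segs generalizing a with
  | nil =>
    obtain rfl : a = b := h
    omega
  | cons s l ih =>
    by_cases ht : t < s.finish
    · exact ⟨s, by simp, by have := h.1; omega, ht⟩
    · obtain ⟨s', hs', h'⟩ := ih h.2.2 (by omega)
      exact ⟨s', by simp [hs'], h'⟩

theorem sum_eq (h : Tiles a b segs) (g : ℕ → ℕ) :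
    ∑ i : Fin segs.length, ∑ t ∈ Finset.Ico (segs.get i).start (segs.get i).finish, g t =
      ∑ t ∈ Finset.Ico a b, g t := by
  induction segs generalizing a with
  | nil =>
    obtain rfl : a = b := h
    simp
  | cons s l ih =>
    obtain ⟨rfl, h₂, h₃⟩ := h
    have := ih h₃
    simp only [List.length_cons, Fin.sum_univ_succ, List.get_cons_zero, List.get_cons_succ']
    rw [this, Finset.sum_Ico_consecutive _ h₂.le h₃.le]

theorem index_unique (h : Tiles a b segs) {t : ℕ} {i i' : Fin segs.length}
    (h₁ : (segs.get i).start ≤ t) (h₂ : t < (segs.get i).finish)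
    (h₃ : (segs.get i').start ≤ t) (h₄ : t < (segs.get i').finish) : i = i' := by
  have hp := List.pairwise_iff_get.1 h.pairwise
  rcases lt_trichotomy i i' with hlt | heq | hgt
  · have := hp i i' hlt; omega
  · exact heq
  · have := hp i' i hgt; omega

theorem exists_index (h : Tiles a b segs) {t : ℕ} (h₁ : a ≤ t) (h₂ : t < b) :
    ∃ i : Fin segs.length, (segs.get i).start ≤ t ∧ t < (segs.get i).finish := by
  obtain ⟨s, hs, h'⟩ := h.exists_mem h₁ h₂
  obtain ⟨i, rfl⟩ := List.mem_iff_get.1 hs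
  exact ⟨i, h'⟩

end Tiles

theorem tiles_splitAt {a b : ℕ} {segs : List Seg} (x : ℕ) (h : Tiles a b segs) :
    Tiles a b (splitAt x segs).val := by
  induction segs generalizing a with
  | nil => exact h
  | cons s l ih =>
    obtain ⟨h₁, h₂, h₃⟩ := h
    simp only [splitAt, bind_val]
    split_ifs with hx
    · exact ⟨h₁, by simpa [h₁] using hx.1, rfl, hx.2, h₃⟩
    · exact ⟨h₁, h₂, ih h₃⟩

theorem exists_of_mem_splitAt {x : ℕ} {segs : List Seg} {s' : Seg}
    (h : s' ∈ (splitAt x segs).val) : ∃ s ∈ segs, s.start ≤ s'.start ∧ s'.finish ≤ s.finish ∧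
      s'.lo = s.lo ∧ s'.up = s.up := by
  induction segs with
  | nil => simp [splitAt] at h
  | cons s l ih =>
    simp only [splitAt, bind_val] at h
    split_ifs at h with hx
    · simp only [pure_val, List.mem_cons] at h
      rcases h with rfl | rfl | h
      · exact ⟨s, by simp, le_rfl, hx.2.le, rfl, rfl⟩
      · exact ⟨s, by simp, hx.1.le, le_rfl, rfl, rfl⟩
      · exact ⟨s', by simp [h], le_rfl, le_rfl, rfl, rfl⟩
    · simp only [bind_val, pure_val, List.mem_cons] at h
      rcases h with rfl | h
      · exact ⟨s', by simp, le_rfl, le_rfl, rfl, rfl⟩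
      · obtain ⟨s'', hs'', h'⟩ := ih h
        exact ⟨s'', by simp [hs''], h'⟩

theorem cutAt_splitAt_self {a b : ℕ} {segs : List Seg} (x : ℕ) (h : Tiles a b segs) :
    CutAt x (splitAt x segs).val := by
  induction segs generalizing a with
  | nil =>
    intro s hs
    simp [splitAt] at hs
  | cons s l ih =>
    obtain ⟨h₁, h₂, h₃⟩ := h
    intro s' hs'
    simp only [splitAt, bind_val] at hs'
    split_ifs at hs' with hx
    · simp only [pure_val, List.mem_cons] at hs'
      rcases hs' with rfl | rfl | hs'
      · simp
      · simp
      · have := h₃.of_mem hs'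
        omega
    · simp only [bind_val, pure_val, List.mem_cons] at hs'
      rcases hs' with rfl | hs'
      · exact hx
      · exact ih h₃ s' hs'

theorem CutAt.splitAt {x y : ℕ} {segs : List Seg} (h : CutAt x segs) :
    CutAt x (splitAt y segs).val := fun s' hs' => by
  obtain ⟨s, hs, h₁, h₂, -, -⟩ := exists_of_mem_splitAt hs'
  have := h s hs
  omega

theorem stores_of_mem_splitAt {x : ℕ} {segs : List Seg} {B : Bounds}
    (h : ∀ s ∈ segs, s.Stores B) : ∀ s ∈ (splitAt x segs).val, s.Stores B := fun s' hs' t h₃ h₄ => by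
  obtain ⟨s, hs, h₁, h₂, hl, hu⟩ := exists_of_mem_splitAt hs'
  rw [hl, hu]
  exact h s hs t (h₁.trans h₃) (h₄.trans_le h₂)

theorem length_splitAt (x : ℕ) (segs : List Seg) :
    segs.length ≤ (splitAt x segs).val.length ∧ (splitAt x segs).val.length ≤ segs.length + 1 := by
  induction segs with
  | nil => simp [splitAt]
  | cons s l ih =>
    simp only [splitAt, bind_val]
    split_ifs
    · simp
    · simp only [bind_val, pure_val, List.length_cons]
      omega

theorem splitAt_time_le (x : ℕ) (segs : List Seg) : (splitAt x segs).time ≤ segs.length + 1 := by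
  induction segs with
  | nil => simp [splitAt]
  | cons s l ih =>
    simp only [splitAt, bind_time, tick_time, List.length_cons]
    split_ifs
    · simp
    · simp only [bind_time, pure_time]
      omega

theorem lowerUp_val (k t t' : ℕ) (segs : List Seg) : (lowerUp k t t' segs).val =
    segs.map fun s => if t ≤ s.start ∧ s.finish ≤ t' then ⟨s.start, s.finish, s.lo, k - 1⟩ else s := by
  induction segs with
  | nil => rfl
  | cons s l ih =>
    simp only [lowerUp, bind_val, ih, List.map_cons]
    split_ifs <;> rfl

theorem raiseLo_val (k t t' : ℕ) (segs : List Seg) : (raiseLo k t t' segs).val =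
    segs.map fun s =>
      if t ≤ s.start ∧ s.finish ≤ t' then ⟨s.start, s.finish, max k s.lo, s.up⟩ else s := by
  induction segs with
  | nil => rfl
  | cons s l ih =>
    simp only [raiseLo, bind_val, ih, List.map_cons]
    split_ifs <;> rfl

theorem lowerUp_time (k t t' : ℕ) (segs : List Seg) :
    (lowerUp k t t' segs).time = segs.length + 1 := by
  induction segs with
  | nil => rfl
  | cons s l ih =>
    simp only [lowerUp, bind_time, tick_time, ih, List.length_cons]
    split_ifs <;> simp <;> omega

theorem raiseLo_time (k t t' : ℕ) (segs : List Seg) :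
    (raiseLo k t t' segs).time = segs.length + 1 := by
  induction segs with
  | nil => rfl
  | cons s l ih =>
    simp only [raiseLo, bind_time, tick_time, ih, List.length_cons]
    split_ifs <;> simp <;> omega

theorem tiles_map {a b : ℕ} {segs : List Seg} {g : Seg → Seg} (hs : ∀ s, (g s).start = s.start)
    (hf : ∀ s, (g s).finish = s.finish) (h : Tiles a b segs) : Tiles a b (segs.map g) := by
  induction segs generalizing a with
  | nil => exact h
  | cons s l ih =>
    refine ⟨(hs s).trans h.1, ?_, ?_⟩
    · rw [hf]; exact h.2.1
    · rw [hf]; exact ih h.2.2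

theorem CutAt.map {x : ℕ} {segs : List Seg} {g : Seg → Seg} (hs : ∀ s, (g s).start = s.start)
    (hf : ∀ s, (g s).finish = s.finish) (h : CutAt x segs) : CutAt x (segs.map g) := by
  intro s' hs'
  obtain ⟨s, hs'', rfl⟩ := List.mem_map.1 hs'
  rw [hs, hf]
  exact h s hs''

/-! ### Segment lists that represent bounds, and their updates -/

namespace Instance

variable {n : ℕ} (I : Instance n)

/-- The segments partition the time horizon, refine the execution intervals of all jobs, and store
the bounds `B`. -/
structure ValidSegs (segs : List Seg) (B : Bounds) : Prop where
  tiles : Tiles 0 (I.d + 1) segs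
  stores : ∀ s ∈ segs, s.Stores B
  cut_release : ∀ j, CutAt (I.job j).release segs
  cut_deadline : ∀ j, CutAt ((I.job j).deadline + 1) segs

namespace ValidSegs

variable {I} {segs : List Seg} {B : Bounds}

theorem splitAt (h : I.ValidSegs segs B) (x : ℕ) : I.ValidSegs (splitAt x segs).val B where
  tiles := tiles_splitAt x h.tiles
  stores := stores_of_mem_splitAt h.stores
  cut_release j := (h.cut_release j).splitAt
  cut_deadline j := (h.cut_deadline j).splitAt

/-- After the cuts at `t` and `t'` every segment lies inside `[t, t')` or is disjoint from it, so
updating whole segments agrees with updating slots. -/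
theorem setIdle (h : I.ValidSegs segs B) (k t t' : ℕ) :
    I.ValidSegs (setIdleSegs k t t' segs).val (B.setIdle k t t') := by
  have h₂ := (h.splitAt t).splitAt t'
  have hc : CutAt t _ := (cutAt_splitAt_self t h.tiles).splitAt (y := t')
  have hc' := cutAt_splitAt_self t' (h.splitAt t).tiles
  simp only [setIdleSegs, bind_val, lowerUp_val]
  have hs : ∀ s : Seg, (if t ≤ s.start ∧ s.finish ≤ t' then
    (⟨s.start, s.finish, s.lo, k - 1⟩ : Seg) else s).start = s.start := fun s => by
      split_ifs <;> rfl
  have hf : ∀ s : Seg, (if t ≤ s.start ∧ s.finish ≤ t' then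
    (⟨s.start, s.finish, s.lo, k - 1⟩ : Seg) else s).finish = s.finish := fun s => by
      split_ifs <;> rfl
  refine ⟨tiles_map hs hf h₂.tiles, fun s' hs' => ?_, fun j => (h₂.cut_release j).map hs hf,
    fun j => (h₂.cut_deadline j).map hs hf⟩
  obtain ⟨s, hs'', rfl⟩ := List.mem_map.1 hs'
  intro x hx₁ hx₂
  rw [hs] at hx₁
  rw [hf] at hx₂
  have h₃ := h₂.stores s hs'' x hx₁ hx₂
  have h₄ := hc s hs''
  have h₅ := hc' s hs''
  simp only [Bounds.setIdle]
  split_ifs with h₆ h₇ h₇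
  · exact ⟨h₃.1, rfl⟩
  · omega
  · omega
  · exact h₃

theorem setBusy (h : I.ValidSegs segs B) (k t t' : ℕ) :
    I.ValidSegs (setBusySegs k t t' segs).val (B.setBusy k t t') := by
  have h₂ := (h.splitAt t).splitAt t'
  have hc : CutAt t _ := (cutAt_splitAt_self t h.tiles).splitAt (y := t')
  have hc' := cutAt_splitAt_self t' (h.splitAt t).tiles
  simp only [setBusySegs, bind_val, raiseLo_val]
  have hs : ∀ s : Seg, (if t ≤ s.start ∧ s.finish ≤ t' then
    (⟨s.start, s.finish, max k s.lo, s.up⟩ : Seg) else s).start = s.start := fun s => by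
      split_ifs <;> rfl
  have hf : ∀ s : Seg, (if t ≤ s.start ∧ s.finish ≤ t' then
    (⟨s.start, s.finish, max k s.lo, s.up⟩ : Seg) else s).finish = s.finish := fun s => by
      split_ifs <;> rfl
  refine ⟨tiles_map hs hf h₂.tiles, fun s' hs' => ?_, fun j => (h₂.cut_release j).map hs hf,
    fun j => (h₂.cut_deadline j).map hs hf⟩
  obtain ⟨s, hs'', rfl⟩ := List.mem_map.1 hs'
  intro x hx₁ hx₂
  rw [hs] at hx₁
  rw [hf] at hx₂
  have h₃ := h₂.stores s hs'' x hx₁ hx₂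
  have h₄ := hc s hs''
  have h₅ := hc' s hs''
  simp only [Bounds.setBusy]
  split_ifs with h₆ h₇ h₇
  · exact ⟨by rw [h₃.1], h₃.2⟩
  · omega
  · omega
  · exact h₃

theorem toStores (h : I.ValidSegs segs B) : I.Stores segs B := by
  refine ⟨fun t ht => ?_, fun s hs t h₁ h₂ => ⟨?_, h.stores s hs t h₁ h₂⟩⟩
  · obtain ⟨i, hi⟩ := h.tiles.exists_index (Nat.zero_le t) (Nat.lt_succ_of_le ht)
    exact ⟨i, hi, fun i' hi' => h.tiles.index_unique hi'.1 hi'.2 hi.1 hi.2⟩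
  · have := (h.tiles.of_mem hs).2.2
    omega

/-- A segment that meets the execution interval of a job is contained in it. -/
theorem window_of_mem (h : I.ValidSegs segs B) {s : Seg} (hs : s ∈ segs) {t : ℕ} {j : Fin n}
    (h₁ : s.start ≤ t) (h₂ : t < s.finish) (h₃ : (I.job j).release ≤ t)
    (h₄ : t ≤ (I.job j).deadline) :
    (I.job j).release ≤ s.start ∧ s.finish ≤ (I.job j).deadline + 1 := by
  have := h.cut_release j s hs
  have := h.cut_deadline j s hs
  omega

end ValidSegs

end Instance

theorem length_setIdleSegs (k t t' : ℕ) (segs : List Seg) :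
    segs.length ≤ (setIdleSegs k t t' segs).val.length ∧
      (setIdleSegs k t t' segs).val.length ≤ segs.length + 2 := by
  simp only [setIdleSegs, bind_val, lowerUp_val, List.length_map]
  have h₁ := length_splitAt t segs
  have h₂ := length_splitAt t' (splitAt t segs).val
  omega

theorem length_setBusySegs (k t t' : ℕ) (segs : List Seg) :
    segs.length ≤ (setBusySegs k t t' segs).val.length ∧
      (setBusySegs k t t' segs).val.length ≤ segs.length + 2 := by
  simp only [setBusySegs, bind_val, raiseLo_val, List.length_map]
  have h₁ := length_splitAt t segs
  have h₂ := length_splitAt t' (splitAt t segs).val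
  omega

theorem setIdleSegs_time_le (k t t' : ℕ) (segs : List Seg) :
    (setIdleSegs k t t' segs).time ≤ 3 * segs.length + 6 := by
  simp only [setIdleSegs, bind_time, lowerUp_time]
  have h₁ := length_splitAt t segs
  have h₂ := length_splitAt t' (splitAt t segs).val
  have h₃ := splitAt_time_le t segs
  have h₄ := splitAt_time_le t' (splitAt t segs).val
  omega

theorem setBusySegs_time_le (k t t' : ℕ) (segs : List Seg) :
    (setBusySegs k t t' segs).time ≤ 3 * segs.length + 6 := by
  simp only [setBusySegs, bind_time, raiseLo_time]
  have h₁ := length_splitAt t segs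
  have h₂ := length_splitAt t' (splitAt t segs).val
  have h₃ := splitAt_time_le t segs
  have h₄ := splitAt_time_le t' (splitAt t segs).val
  omega

/-! ## Wrap-around schedules

Within a time interval of length `len`, the cell `k * len + o` stands for the slot with offset `o` on
processor `k`; the jobs are laid out in the cells one after the other. -/

/-- The number of cells in front of the cells of job `j`. -/
def cellsBefore {n : ℕ} (x : Fin n → ℕ) (j : ℕ) : ℕ :=
  ∑ i ∈ Finset.range j, if h : i < n then x ⟨i, h⟩ else 0

section Cells

variable {n : ℕ} (x : Fin n → ℕ)

theorem cellsBefore_zero : cellsBefore x 0 = 0 := rfl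

theorem cellsBefore_succ (j : Fin n) : cellsBefore x (j + 1) = cellsBefore x j + x j := by
  simp [cellsBefore, Finset.sum_range_succ]

theorem cellsBefore_mono : Monotone (cellsBefore x) := fun _ _ hab =>
  Finset.sum_le_sum_of_subset (Finset.range_subset_range.2 hab)

theorem cellsBefore_last : cellsBefore x n = ∑ j, x j := by
  simp [cellsBefore, Finset.sum_range]

/-- The job in cell `q`. -/
noncomputable def cell (q : ℕ) : Option (Fin n) :=
  open Classical in
  if h : ∃ j : Fin n, cellsBefore x j ≤ q ∧ q < cellsBefore x (j + 1) then some h.choose else none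

theorem cell_eq_some {q : ℕ} {j : Fin n} :
    cell x q = some j ↔ cellsBefore x j ≤ q ∧ q < cellsBefore x (j + 1) := by
  unfold cell
  have uniq : ∀ i i' : Fin n, q < cellsBefore x (i + 1) → cellsBefore x i' ≤ q → i' ≤ i := by
    intro i i' h₁ h₂
    by_contra! hlt
    have := cellsBefore_mono x (show (i : ℕ) + 1 ≤ i' from hlt)
    omega
  split_ifs with h
  · have hs := h.choose_spec
    constructor
    · intro h'
      rwa [Option.some.inj h'] at hs
    · intro h'
      rw [le_antisymm (uniq j _ h'.2 hs.1) (uniq _ j hs.2 h'.1)]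
  · simp only [false_iff]
    exact fun h' => h ⟨j, h'⟩

/-- The occupied cells form an initial segment. Both the preference for lower-numbered processors
and the count of busy processors rest on this. -/
theorem isSome_cell {q : ℕ} : (cell x q).isSome ↔ q < ∑ j, x j := by
  constructor
  · intro h
    obtain ⟨j, hj⟩ := Option.isSome_iff_exists.1 h
    have := cellsBefore_mono x (show (j : ℕ) + 1 ≤ n from j.2)
    rw [cellsBefore_last] at this
    exact ((cell_eq_some x).1 hj).2.trans_le this
  · intro h
    by_contra hne
    have key : ∀ a ≤ n, cellsBefore x a ≤ q := by
      intro a ha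
      induction a with
      | zero => exact Nat.zero_le _
      | succ a ih =>
        by_contra! hlt
        exact hne (Option.isSome_iff_exists.2
          ⟨⟨a, ha⟩, (cell_eq_some x).2 ⟨ih (by omega), hlt⟩⟩)
    have := key n le_rfl
    rw [cellsBefore_last] at this
    omega

end Cells

theorem mul_add_lt_iff {L p k o o' : ℕ} (ho : o < L) (ho' : o' < L) :
    k * L + o < p * L + o' ↔ k < p ∨ (k = p ∧ o < o') := by
  rcases lt_trichotomy k p with h | rfl | h
  · have := Nat.mul_le_mul_right L (show k + 1 ≤ p from h)
    rw [Nat.add_mul] at this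
    omega
  · simp
  · have := Nat.mul_le_mul_right L (show p + 1 ≤ k from h)
    rw [Nat.add_mul] at this
    omega

/-- The number of slots in which a job with consecutive cells runs. -/
theorem card_slots_cells {m L a A X : ℕ} (hX : X ≤ L) (hm : A + X ≤ m * L) :
    ((Finset.Ico a (a + L)).filter fun t => ∃ k : Fin m,
      A ≤ k * L + (t - a) ∧ k * L + (t - a) < A + X).card = X := by
  rcases Nat.eq_zero_or_pos L with rfl | hL
  · obtain rfl : X = 0 := by omega
    simp
  refine Eq.trans (Eq.symm ?_) (show (Finset.Ico A (A + X)).card = X by simp)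
  -- A cell is sent to its slot. Distinct cells of the same slot are at least `L` apart, so `X ≤ L`
  -- consecutive cells never collide.
  refine Finset.card_bij (fun q _ => a + q % L) ?_ ?_ ?_
  · intro q hq
    rw [Finset.mem_Ico] at hq
    have hmod := Nat.mod_lt q hL
    have hdiv := Nat.div_add_mod' q L
    simp only [Finset.mem_filter, Finset.mem_Ico]
    refine ⟨by omega, ⟨q / L, ?_⟩, ?_⟩
    · rw [Nat.div_lt_iff_lt_mul hL]
      omega
    · simp only [Nat.add_sub_cancel_left, hdiv]
      exact hq
  · intro q hq q' hq' h
    rw [Finset.mem_Ico] at hq hq'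
    have hmod : q % L = q' % L := by omega
    have h₁ := Nat.div_add_mod' q L
    have h₂ := Nat.div_add_mod' q' L
    rcases lt_trichotomy (q / L) (q' / L) with hlt | heq | hgt
    · have := Nat.mul_le_mul_right L (show q / L + 1 ≤ q' / L from hlt)
      rw [Nat.add_mul] at this
      omega
    · rw [← h₁, ← h₂, heq, hmod]
    · have := Nat.mul_le_mul_right L (show q' / L + 1 ≤ q / L from hgt)
      rw [Nat.add_mul] at this
      omega
  · intro t ht
    simp only [Finset.mem_filter, Finset.mem_Ico] at ht
    obtain ⟨ht, k, hk⟩ := ht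
    refine ⟨k * L + (t - a), Finset.mem_Ico.2 hk, ?_⟩
    rw [Nat.mul_add_mod_self_right, Nat.mod_eq_of_lt (by omega)]
    omega

/-- The length of a segment. -/
abbrev Seg.len (s : Seg) : ℕ := s.finish - s.start

/-- The schedule that is obtained by wrap-around within every segment, where job `j` runs in `x j i`
slots of segment `i`. -/
noncomputable def wrapAround {n : ℕ} (m : ℕ) (segs : List Seg) (x : Fin n → Fin segs.length → ℕ) :
    Schedule m n := fun k t =>
  open Classical in
  if h : ∃ i : Fin segs.length, (segs.get i).start ≤ t ∧ t < (segs.get i).finish then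
    cell (fun j => x j h.choose)
      (k * (segs.get h.choose).len + (t - (segs.get h.choose).start))
  else none

theorem wrapAround_eq_cell {n m a b : ℕ} {segs : List Seg} (hT : Tiles a b segs)
    (x : Fin n → Fin segs.length → ℕ) (k : Fin m) {t : ℕ} {i : Fin segs.length}
    (h₁ : (segs.get i).start ≤ t) (h₂ : t < (segs.get i).finish) :
    wrapAround m segs x k t =
      cell (fun j => x j i) (k * (segs.get i).len + (t - (segs.get i).start)) := by
  have h : ∃ i : Fin segs.length, (segs.get i).start ≤ t ∧ t < (segs.get i).finish :=
    ⟨i, h₁, h₂⟩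
  have hi := hT.index_unique h.choose_spec.1 h.choose_spec.2 h₁ h₂
  unfold wrapAround
  rw [dif_pos h, hi]

theorem wrapAround_eq_some {n m a b : ℕ} {segs : List Seg} (hT : Tiles a b segs)
    (x : Fin n → Fin segs.length → ℕ) (k : Fin m) (t : ℕ) (j : Fin n) :
    wrapAround m segs x k t = some j ↔ ∃ i : Fin segs.length,
      ((segs.get i).start ≤ t ∧ t < (segs.get i).finish) ∧
      cellsBefore (fun j => x j i) j ≤ k * (segs.get i).len + (t - (segs.get i).start) ∧
      k * (segs.get i).len + (t - (segs.get i).start) < cellsBefore (fun j => x j i) (j + 1) := by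
  constructor
  · intro h
    by_cases hi : ∃ i : Fin segs.length, (segs.get i).start ≤ t ∧ t < (segs.get i).finish
    · obtain ⟨i, h₁, h₂⟩ := hi
      rw [wrapAround_eq_cell hT x k h₁ h₂, cell_eq_some] at h
      exact ⟨i, ⟨h₁, h₂⟩, h⟩
    · unfold wrapAround at h
      rw [dif_neg hi] at h
      cases h
  · rintro ⟨i, ⟨h₁, h₂⟩, h⟩
    rwa [wrapAround_eq_cell hT x k h₁ h₂, cell_eq_some]

/-! ### Allotments and their wrap-around schedules -/

namespace Instance

variable {n : ℕ} {I : Instance n}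

theorem card_fin_le {m u : ℕ} {p : Fin m → Prop} [DecidablePred p] (h : ∀ k, p k → (k : ℕ) < u) :
    (Finset.univ.filter p).card ≤ u := by
  refine (Finset.card_le_card_of_injOn (t := Finset.range u) Fin.val (fun k hk => ?_)
    (Fin.val_injective.injOn)).trans (by simp)
  simpa using h k (by simpa using hk)

theorem le_card_fin {m l : ℕ} {p : Fin m → Prop} [DecidablePred p] (hl : l ≤ m)
    (h : ∀ k : Fin m, (k : ℕ) < l → p k) : l ≤ (Finset.univ.filter p).card := by
  calc l = (Finset.univ.map (Fin.castLEEmb hl)).card := by simp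
    _ ≤ _ := Finset.card_le_card fun k hk => by
      obtain ⟨i, -, rfl⟩ := Finset.mem_map.1 hk
      simpa using h _ (by simp)

/-- The amounts `x j i` in which job `j` is processed in segment `i` fulfill all requirements. -/
structure IsAllotment (I : Instance n) (segs : List Seg) (x : Fin n → Fin segs.length → ℕ) :
    Prop where
  le_len : ∀ j i, x j i ≤ (segs.get i).len
  window : ∀ j i, x j i ≠ 0 →
    (I.job j).release ≤ (segs.get i).start ∧ (segs.get i).finish ≤ (I.job j).deadline + 1
  volume : ∀ j, ∑ i, x j i = (I.job j).volume
  lo_le : ∀ i, (segs.get i).lo * (segs.get i).len ≤ ∑ j, x j i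
  le_up : ∀ i, ∑ j, x j i ≤ (segs.get i).up * (segs.get i).len

theorem wrapAround_stair {a b m : ℕ} {segs : List Seg} (hT : Tiles a b segs)
    (x : Fin n → Fin segs.length → ℕ) : (wrapAround m segs x).Stair := by
  intro t k k' hk h
  obtain ⟨j, hj⟩ := Option.isSome_iff_exists.1 h
  obtain ⟨i, ⟨h₁, h₂⟩, -⟩ := (wrapAround_eq_some hT x k t j).1 hj
  rw [wrapAround_eq_cell hT x _ h₁ h₂, isSome_cell] at h ⊢
  have := Nat.mul_le_mul_right (segs.get i).len (Fin.le_def.1 hk)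
  omega

namespace IsAllotment

variable {segs : List Seg} {B : Bounds} {x : Fin n → Fin segs.length → ℕ}

/-- A job running twice in a slot would own two cells at least one segment length apart, but its
cells in the segment are consecutive and no more numerous than that length. Volumes add up over
segments by `card_slots_cells`; the cells fit on `I.m` processors because of `hm`. -/
theorem isFeasible (h : I.IsAllotment segs x) (hV : I.ValidSegs segs B)
    (hm : ∀ s ∈ segs, s.up ≤ I.m) : I.IsFeasible (wrapAround I.m segs x) := by
  have hT := hV.tiles
  refine ⟨fun k t j hk => ?_, fun t j k k' hk hk' => ?_, fun j => ?_⟩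
  · obtain ⟨i, ⟨h₁, h₂⟩, h₃, h₄⟩ := (wrapAround_eq_some hT x k t j).1 hk
    rw [cellsBefore_succ] at h₄
    have := h.window j i (by omega)
    omega
  · obtain ⟨i, ⟨h₁, h₂⟩, h₃, h₄⟩ := (wrapAround_eq_some hT x k t j).1 hk
    rw [wrapAround_eq_cell hT x k' h₁ h₂, cell_eq_some] at hk'
    obtain ⟨h₅, h₆⟩ := hk'
    rw [cellsBefore_succ] at h₄ h₆
    have hle := h.le_len j i
    rcases lt_trichotomy k k' with hlt | heq | hgt
    · have := Nat.mul_le_mul_right (segs.get i).len (show (k : ℕ) + 1 ≤ k' from hlt)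
      rw [Nat.add_mul] at this
      omega
    · exact heq
    · have := Nat.mul_le_mul_right (segs.get i).len (show (k' : ℕ) + 1 ≤ k from hgt)
      rw [Nat.add_mul] at this
      omega
  · rw [← h.volume j, Finset.card_filter, Finset.range_eq_Ico, ← hT.sum_eq]
    refine Finset.sum_congr rfl fun i _ => ?_
    have hlt := (hT.of_mem (segs.get_mem i)).2.1
    rw [← Finset.card_filter]
    have hcard := card_slots_cells (m := I.m) (a := (segs.get i).start)
      (A := cellsBefore (fun j => x j i) j) (h.le_len j i) (by
        rw [← cellsBefore_succ (fun j => x j i) j]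
        refine (cellsBefore_mono _ (show (j : ℕ) + 1 ≤ n from j.2)).trans ?_
        rw [cellsBefore_last]
        exact (h.le_up i).trans (Nat.mul_le_mul_right _ (hm _ (segs.get_mem i))))
    rw [show (segs.get i).start + (segs.get i).len = (segs.get i).finish by
      simp only [Seg.len]; omega] at hcard
    rw [← hcard]
    congr 1
    refine Finset.filter_congr fun t ht => exists_congr fun k => ?_
    rw [Finset.mem_Ico] at ht
    rw [wrapAround_eq_cell hT x k ht.1 ht.2, cell_eq_some, cellsBefore_succ (fun j => x j i)]

/-- At offset `o < len`, processor `k` is busy iff `k * len + o` is below the number of occupied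
cells. As this number lies between `lo * len` and `up * len`, all processors below `lo` are busy,
and only processors below `up` are. -/
theorem respects (h : I.IsAllotment segs x) (hV : I.ValidSegs segs B)
    (hm : ∀ s ∈ segs, s.up ≤ I.m) : I.Respects (wrapAround I.m segs x) B := by
  intro t ht
  have hT := hV.tiles
  obtain ⟨i, h₁, h₂⟩ := hT.exists_index (Nat.zero_le t) (Nat.lt_succ_of_le ht)
  have hst := hV.stores _ (segs.get_mem i) t h₁ h₂
  have hlo := h.lo_le i
  have hup := h.le_up i
  have hpos : 0 < (segs.get i).len := by simp only [Seg.len]; omega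
  have ho : t - (segs.get i).start < (segs.get i).len := by simp only [Seg.len]; omega
  have hsome : ∀ k : Fin I.m, (wrapAround I.m segs x k t).isSome ↔
      k * (segs.get i).len + (t - (segs.get i).start) < ∑ j, x j i := fun k => by
    rw [wrapAround_eq_cell hT x k h₁ h₂, isSome_cell]
  rw [hst.1, hst.2]
  constructor
  · refine le_card_fin ?_ fun k hk => (hsome k).2 ?_
    · exact (Nat.le_of_mul_le_mul_right (hlo.trans hup) hpos).trans (hm _ (segs.get_mem i))
    · have := (mul_add_lt_iff ho hpos).2 (Or.inl hk)
      omega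
  · refine card_fin_le fun k hk => ?_
    have := (hsome k).1 hk
    have := (mul_add_lt_iff ho hpos).1 (this.trans_le hup)
    omega

end IsAllotment

end Instance

/-! ## The pieces of a wrap-around schedule -/

theorem foldl_finRange_induction {n : ℕ} {β : Type} {f : β → Fin n → β} {b : β}
    (motive : ℕ → β → Prop) (zero : motive 0 b)
    (succ : ∀ (j : Fin n) b, motive j b → motive (j + 1) (f b j)) :
    motive n ((List.finRange n).foldl f b) := by
  induction n with
  | zero => simpa using zero
  | succ n ih =>
    rw [List.finRange_succ_last, List.foldl_append, List.foldl_map]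
    exact succ (Fin.last n) _ (ih (f := fun b j => f b j.castSucc) fun j b => succ j.castSucc b)

/-- According to the list of pieces, job `j` runs on processor `k` in slot `t`. -/
def Covers {n : ℕ} (pieces : List (Piece n)) (k t : ℕ) (j : Fin n) : Prop :=
  ∃ q ∈ pieces, q.proc = k ∧ q.job = j ∧ q.start ≤ t ∧ t < q.finish

theorem covers_cons {n : ℕ} {q : Piece n} {pieces : List (Piece n)} {k t : ℕ} {j : Fin n} :
    Covers (q :: pieces) k t j ↔
      (q.proc = k ∧ q.job = j ∧ q.start ≤ t ∧ t < q.finish) ∨ Covers pieces k t j := by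
  simp [Covers]

/-- Loop invariant: processor `p` and offset `o < L` address the first free cell `p * L + o`. Since
`x j ≤ L`, a job spills over to at most one further processor. -/
theorem covers_fillInterval {n a L : ℕ} (hL : 0 < L) {x : Fin n → ℕ} (hx : ∀ j, x j ≤ L)
    (pieces : List (Piece n)) (k t : ℕ) (j : Fin n) :
    Covers (fillInterval a L x pieces).val k t j ↔ Covers pieces k t j ∨
      (a ≤ t ∧ t < a + L) ∧ cellsBefore x j ≤ k * L + (t - a) ∧
        k * L + (t - a) < cellsBefore x (j + 1) := by
  simp only [fillInterval, bind_val, pure_val, fold_val]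
  have := foldl_finRange_induction (n := n) (b := ((0, 0, pieces) : ℕ × ℕ × List (Piece n)))
    (f := fun st j => (if st.2.1 + x j < L then
      pure (st.1, st.2.1 + x j, ⟨st.1, j, a + st.2.1, a + st.2.1 + x j⟩ :: st.2.2)
    else
      pure (st.1 + 1, st.2.1 + x j - L,
        ⟨st.1 + 1, j, a, a + (st.2.1 + x j - L)⟩ ::
        ⟨st.1, j, a + st.2.1, a + L⟩ :: st.2.2) : Timed (ℕ × ℕ × List (Piece n))).val)
    (fun b st => st.2.1 < L ∧ st.1 * L + st.2.1 = cellsBefore x b ∧ ∀ k t (i : Fin n),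
      Covers st.2.2 k t i ↔ Covers pieces k t i ∨ ((i : ℕ) < b ∧ (a ≤ t ∧ t < a + L) ∧
        cellsBefore x i ≤ k * L + (t - a) ∧ k * L + (t - a) < cellsBefore x (i + 1)))
    ⟨hL, by simp [cellsBefore_zero], by simp⟩ ?_
  · rw [this.2.2]
    simp
  · rintro i ⟨p, o, ps⟩ ⟨ho, hpo, hc⟩
    dsimp only at hpo ho
    have hxi := hx i
    have hsucc := cellsBefore_succ x i
    have hnew : ∀ k t, ((a ≤ t ∧ t < a + L) ∧ cellsBefore x i ≤ k * L + (t - a) ∧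
        k * L + (t - a) < cellsBefore x (i + 1)) ↔
        (k = p ∧ a + o ≤ t ∧ t < a + L ∧ t < a + o + x i) ∨
        (k = p + 1 ∧ a ≤ t ∧ t < a + (o + x i - L)) := by
      intro k t
      have h₁ : (p + 1) * L = p * L + L := by ring
      rw [hsucc, ← hpo]
      rcases lt_trichotomy k p with h | rfl | h
      · have := Nat.mul_le_mul_right L (show k + 1 ≤ p from h)
        rw [Nat.add_mul] at this
        omega
      · omega
      · rcases (show p + 1 ≤ k from h).eq_or_lt with rfl | h
        · omega
        · have := Nat.mul_le_mul_right L (show p + 1 + 1 ≤ k from h)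
          rw [Nat.add_mul] at this
          omega
    have hlt : ∀ i' : Fin n, (i' : ℕ) < i + 1 ↔ (i' : ℕ) < i ∨ i = i' := by
      intro i'
      rw [Fin.ext_iff]
      omega
    have hsplit : ∀ k t (i' : Fin n), (Covers ps k t i' ∨
        (i = i' ∧ ((k = p ∧ a + o ≤ t ∧ t < a + L ∧ t < a + o + x i) ∨
        (k = p + 1 ∧ a ≤ t ∧ t < a + (o + x i - L))))) ↔
        Covers pieces k t i' ∨ ((i' : ℕ) < i + 1 ∧ (a ≤ t ∧ t < a + L) ∧
        cellsBefore x i' ≤ k * L + (t - a) ∧ k * L + (t - a) < cellsBefore x (i' + 1)) := by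
      intro k t i'
      rw [hc, hlt, or_and_right, or_assoc]
      refine or_congr Iff.rfl (or_congr Iff.rfl (and_congr_right fun h => ?_))
      subst h
      exact (hnew k t).symm
    dsimp only
    split_ifs with h
    · simp only [pure_val]
      refine ⟨h, by omega, fun k t i' => ?_⟩
      rw [← hsplit, covers_cons, or_comm]
      refine or_congr Iff.rfl ?_
      dsimp only
      constructor
      · rintro ⟨h₁, h₂, h₃, h₄⟩
        exact ⟨h₂, by omega⟩
      · rintro ⟨h₁, h₂⟩
        exact ⟨by omega, h₁, by omega⟩
    · simp only [pure_val]
      have h₁ : (p + 1) * L = p * L + L := by ring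
      refine ⟨by omega, by omega, fun k t i' => ?_⟩
      rw [← hsplit, covers_cons, covers_cons, ← or_assoc, or_comm]
      refine or_congr Iff.rfl ?_
      dsimp only
      constructor
      · rintro (⟨h₁, h₂, h₃, h₄⟩ | ⟨h₁, h₂, h₃, h₄⟩)
        · exact ⟨h₂, by omega⟩
        · exact ⟨h₂, by omega⟩
      · rintro ⟨h₁, h₂ | h₂⟩
        · exact Or.inr ⟨by omega, h₁, by omega⟩
        · exact Or.inl ⟨by omega, h₁, by omega⟩

theorem fillInterval_time_le {n : ℕ} (a L : ℕ) (x : Fin n → ℕ) (pieces : List (Piece n)) :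
    (fillInterval a L x pieces).time ≤ n + 1 := by
  simp only [fillInterval, bind_time, pure_time]
  refine (fold_time_le _ _ _ 0 fun b j _ => ?_).trans (by simp)
  split_ifs <;> simp

/-- The pieces computed by filling all segments. -/
theorem describes_wrapAround {n m b : ℕ} {segs : List Seg} (hT : Tiles 0 b segs)
    {x : Fin n → Fin segs.length → ℕ} (hx : ∀ j i, x j i ≤ (segs.get i).len)
    (hm : ∀ i, ∑ j, x j i ≤ m * (segs.get i).len) :
    Describes (fold (fun pieces i => fillInterval (segs.get i).start (segs.get i).len
      (fun j => x j i) pieces) [] (List.finRange segs.length)).val (wrapAround m segs x) := by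
  rw [fold_val]
  set pieces := (List.finRange segs.length).foldl (fun pieces i =>
    (fillInterval (segs.get i).start (segs.get i).len (fun j => x j i) pieces).val) [] with hp
  have hcov : ∀ k t j, Covers pieces k t j ↔ ∃ i : Fin segs.length,
      ((segs.get i).start ≤ t ∧ t < (segs.get i).finish) ∧
      cellsBefore (fun j => x j i) j ≤ k * (segs.get i).len + (t - (segs.get i).start) ∧
      k * (segs.get i).len + (t - (segs.get i).start) < cellsBefore (fun j => x j i) (j + 1) := by
    have := foldl_finRange_induction (b := ([] : List (Piece n)))
      (f := fun pieces (i : Fin segs.length) =>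
        (fillInterval (segs.get i).start (segs.get i).len (fun j => x j i) pieces).val)
      (fun b ps => ∀ k t j, Covers ps k t j ↔ ∃ i : Fin segs.length, (i : ℕ) < b ∧
        ((segs.get i).start ≤ t ∧ t < (segs.get i).finish) ∧
        cellsBefore (fun j => x j i) j ≤ k * (segs.get i).len + (t - (segs.get i).start) ∧
        k * (segs.get i).len + (t - (segs.get i).start) < cellsBefore (fun j => x j i) (j + 1))
      (by simp [Covers]) ?_
    · intro k t j
      rw [hp, this]
      simp
    · intro i ps ih k t j
      have hlt := (hT.of_mem (segs.get_mem i)).2.1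
      have hlen : (segs.get i).start + (segs.get i).len = (segs.get i).finish := by
        simp only [Seg.len]; omega
      rw [covers_fillInterval (by simp only [Seg.len]; omega) (fun j => hx j i), ih, hlen]
      constructor
      · rintro (⟨i', h₁, h₂⟩ | h)
        · exact ⟨i', by omega, h₂⟩
        · exact ⟨i, by omega, h⟩
      · rintro ⟨i', h₁, h₂⟩
        rcases (Nat.lt_succ_iff.1 h₁).lt_or_eq with h | h
        · exact Or.inl ⟨i', h, h₂⟩
        · obtain rfl := Fin.ext h
          exact Or.inr h₂
  refine ⟨fun q hq t h₁ h₂ => ?_, fun k t j hk => ?_⟩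
  · obtain ⟨i, ht, h₃, h₄⟩ := (hcov q.proc t q.job).1 ⟨q, hq, rfl, rfl, h₁, h₂⟩
    -- This needs the slot `t` inside the piece: an empty piece may well be placed on processor `m`,
    -- which is harmless.
    have hlt : q.proc < m := by
      have h₅ := (cellsBefore_mono (fun j => x j i) (show (q.job : ℕ) + 1 ≤ n from q.job.2))
      rw [cellsBefore_last] at h₅
      have h₆ := h₄.trans_le (h₅.trans (hm i))
      have hpos : 0 < (segs.get i).len := by simp only [Seg.len]; omega
      have := (mul_add_lt_iff (o' := 0) (by simp only [Seg.len]; omega) hpos).1 h₆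
      omega
    exact ⟨hlt, (wrapAround_eq_some hT x ⟨q.proc, hlt⟩ t q.job).2 ⟨i, ht, h₃, h₄⟩⟩
  · exact (hcov k t j).2 ((wrapAround_eq_some hT x k t j).1 hk)

/-! ## Correctness of the feasibility check -/

theorem foldl_and_eq_true {α : Type} (p : α → Bool) (l : List α) (b : Bool) :
    l.foldl (fun b a => b && p a) b = true ↔ b = true ∧ ∀ a ∈ l, p a = true := by
  induction l generalizing b with
  | nil => simp
  | cons a l ih => simp [ih, and_assoc]

theorem foldl_max_le_iff {α : Type} (g : α → ℕ) (l : List α) (b c : ℕ) :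
    l.foldl (fun x a => max x (g a)) b ≤ c ↔ b ≤ c ∧ ∀ a ∈ l, g a ≤ c := by
  induction l generalizing b with
  | nil => simp
  | cons a l ih => simp [ih, and_assoc]

theorem ordered_val (segs : List Seg) : (ordered segs).val = true ↔ ∀ s ∈ segs, s.lo ≤ s.up := by
  simp only [ordered, fold_val, pure_val]
  rw [foldl_and_eq_true (fun s : Seg => decide (s.lo ≤ s.up))]
  simp

theorem totalLo_val (segs : List Seg) :
    (totalLo segs).val = ∑ i : Fin segs.length, (segs.get i).lo * (segs.get i).len := by
  simp only [totalLo, fold_val, pure_val]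
  rw [foldl_add_eq_sum (fun s : Seg => s.lo * (s.finish - s.start)), zero_add]
  conv_lhs => rw [← List.ofFn_get segs, List.map_ofFn, List.sum_ofFn]
  rfl

theorem ordered_time_le (segs : List Seg) : (ordered segs).time ≤ segs.length + 1 :=
  (fold_time_le _ _ _ 0 (by simp)).trans (by simp)

theorem totalLo_time_le (segs : List Seg) : (totalLo segs).time ≤ segs.length + 1 :=
  (fold_time_le _ _ _ 0 (by simp)).trans (by simp)

theorem sum_map_finRange {n : ℕ} (g : Fin n → ℕ) : ((List.finRange n).map g).sum = ∑ j, g j := by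
  rw [← List.ofFn_eq_map, List.sum_ofFn]

theorem totalVolume_val {n : ℕ} (I : Instance n) :
    (totalVolume I).val = ∑ j, (I.job j).volume := by
  simp only [totalVolume, fold_val, pure_val]
  rw [foldl_add_eq_sum (fun j => (I.job j).volume), zero_add, sum_map_finRange]

theorem totalVolume_time_le {n : ℕ} (I : Instance n) : (totalVolume I).time ≤ n + 1 :=
  (fold_time_le _ _ _ 0 (by simp)).trans (by simp)

theorem lastDeadline_val {n : ℕ} (I : Instance n) : (lastDeadline I).val = I.d := by
  simp only [lastDeadline, fold_val, pure_val]
  refine le_antisymm ?_ ?_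
  · rw [foldl_max_le_iff (fun j => (I.job j).deadline)]
    exact ⟨Nat.zero_le _, fun j _ => Instance.deadline_le_d j⟩
  · refine Finset.sup_le fun j _ => ?_
    exact ((foldl_max_le_iff (fun j => (I.job j).deadline) _ _ _).1 le_rfl).2 j (by simp)

theorem lastDeadline_time_le {n : ℕ} (I : Instance n) : (lastDeadline I).time ≤ n + 1 :=
  (fold_time_le _ _ _ 0 (by simp)).trans (by simp)

theorem sum_node {n s : ℕ} (g : Node n s → ℕ) : ∑ v, g v = ∑ j, g (Node.job j) +
    (∑ i, g (Node.interval i) + (g Node.alpha + g Node.gamma + g Node.omega)) := by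
  rw [Fintype.sum_sum_type, Fintype.sum_sum_type, Fin.sum_univ_three]

/-! ### Flows in the network versus allotments -/

section Flow

variable {n : ℕ} {I : Instance n} {segs : List Seg} {P L : ℕ}
  {φ : Node n segs.length → Node n segs.length → ℕ}

theorem FlowNetwork.IsFlow.eq_zero {V : Type} [Fintype V] {G : FlowNetwork V} {φ : V → V → ℕ}
    (h : G.IsFlow φ) {u v : V} (h₀ : G.cap u v = 0) : φ u v = 0 :=
  Nat.le_zero.1 (h₀ ▸ h.le_cap u v)

theorem FlowNetwork.IsFlow.sum_job (h : (network I segs P L).IsFlow φ) (j : Fin n) :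
    ∑ i, φ (Node.job j) (Node.interval i) = φ Node.alpha (Node.job j) := by
  have hc := h.conserve (Node.job j) (by simp [network]) (by simp [network])
  rw [sum_node, sum_node, Finset.sum_eq_zero fun _ _ => h.eq_zero rfl,
    Finset.sum_eq_zero fun _ _ => h.eq_zero rfl,
    h.eq_zero (u := Node.gamma) (v := Node.job j) rfl,
    h.eq_zero (u := Node.omega) (v := Node.job j) rfl,
    Finset.sum_eq_zero fun _ _ => h.eq_zero rfl,
    h.eq_zero (u := Node.job j) (v := Node.alpha) rfl,
    h.eq_zero (u := Node.job j) (v := Node.gamma) rfl,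
    h.eq_zero (u := Node.job j) (v := Node.omega) rfl] at hc
  omega

theorem FlowNetwork.IsFlow.sum_interval (h : (network I segs P L).IsFlow φ)
    (i : Fin segs.length) : ∑ j, φ (Node.job j) (Node.interval i) =
      φ (Node.interval i) Node.gamma + φ (Node.interval i) Node.omega := by
  have hc := h.conserve (Node.interval i) (by simp [network]) (by simp [network])
  rw [sum_node, sum_node,
    Finset.sum_eq_zero (f := fun x => φ (Node.interval x) _) fun _ _ => h.eq_zero rfl,
    h.eq_zero (u := Node.alpha) (v := Node.interval i) rfl,
    h.eq_zero (u := Node.gamma) (v := Node.interval i) rfl,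
    h.eq_zero (u := Node.omega) (v := Node.interval i) rfl,
    Finset.sum_eq_zero (f := fun x => φ _ (Node.job x)) fun _ _ => h.eq_zero rfl,
    Finset.sum_eq_zero (f := fun x => φ _ (Node.interval x)) fun _ _ => h.eq_zero rfl,
    h.eq_zero (u := Node.interval i) (v := Node.alpha) rfl] at hc
  omega

theorem FlowNetwork.IsFlow.sum_gamma (h : (network I segs P L).IsFlow φ) :
    ∑ i, φ (Node.interval i) Node.gamma = φ Node.gamma Node.omega := by
  have hc := h.conserve Node.gamma (by simp [network]) (by simp [network])
  rw [sum_node, sum_node,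
    Finset.sum_eq_zero (f := fun x => φ (Node.job x) _) fun _ _ => h.eq_zero rfl,
    h.eq_zero (u := Node.alpha) (v := Node.gamma) rfl,
    h.eq_zero (u := Node.gamma) (v := Node.gamma) rfl,
    h.eq_zero (u := Node.omega) (v := Node.gamma) rfl,
    Finset.sum_eq_zero (f := fun x => φ _ (Node.job x)) fun _ _ => h.eq_zero rfl,
    Finset.sum_eq_zero (f := fun x => φ _ (Node.interval x)) fun _ _ => h.eq_zero rfl,
    h.eq_zero (u := Node.gamma) (v := Node.alpha) rfl] at hc
  omega

theorem FlowNetwork.IsFlow.value_eq (h : (network I segs P L).IsFlow φ) :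
    (network I segs P L).value φ = (∑ j, φ Node.alpha (Node.job j) : ℕ) := by
  have h₁ : ∑ v, φ Node.alpha v = ∑ j, φ Node.alpha (Node.job j) := by
    rw [sum_node,
      Finset.sum_eq_zero (f := fun x => φ _ (Node.interval x)) fun _ _ => h.eq_zero rfl,
      h.eq_zero (u := Node.alpha) (v := Node.alpha) rfl,
      h.eq_zero (u := Node.alpha) (v := Node.gamma) rfl,
      h.eq_zero (u := Node.alpha) (v := Node.omega) rfl]
    rfl
  have h₂ : ∑ v, φ v Node.alpha = 0 := by
    rw [sum_node,
      Finset.sum_eq_zero (f := fun x => φ (Node.job x) _) fun _ _ => h.eq_zero rfl,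
      Finset.sum_eq_zero (f := fun x => φ (Node.interval x) _) fun _ _ => h.eq_zero rfl,
      h.eq_zero (u := Node.alpha) (v := Node.alpha) rfl,
      h.eq_zero (u := Node.gamma) (v := Node.alpha) rfl,
      h.eq_zero (u := Node.omega) (v := Node.alpha) rfl]
    rfl
  change (∑ v, (φ Node.alpha v : ℤ)) - ∑ v, (φ v Node.alpha : ℤ) = _
  rw [← Nat.cast_sum, ← Nat.cast_sum, h₁, h₂]
  simp

/-- A flow that saturates all edges at the source yields an allotment. -/
theorem FlowNetwork.IsFlow.isAllotment (h : (network I segs P L).IsFlow φ)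
    (hP : P = ∑ j, (I.job j).volume)
    (hL : L = ∑ i : Fin segs.length, (segs.get i).lo * (segs.get i).len) (hLP : L ≤ P)
    (hord : ∀ s ∈ segs, s.lo ≤ s.up) (hφ : ∑ j, φ Node.alpha (Node.job j) = P) :
    I.IsAllotment segs fun j i => φ (Node.job j) (Node.interval i) := by
  have hα : ∀ j, φ Node.alpha (Node.job j) ≤ (I.job j).volume := fun j => h.le_cap _ _
  have hγ : ∀ i, φ (Node.interval i) Node.gamma ≤
      ((segs.get i).up - (segs.get i).lo) * (segs.get i).len := fun i => h.le_cap _ _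
  have hω : ∀ i, φ (Node.interval i) Node.omega ≤
      (segs.get i).lo * (segs.get i).len := fun i => h.le_cap _ _
  have hγω : φ Node.gamma Node.omega ≤ P - L := h.le_cap _ _
  have hcap : ∀ j i, φ (Node.job j) (Node.interval i) ≤
      if (I.job j).release ≤ (segs.get i).start ∧ (segs.get i).finish ≤ (I.job j).deadline + 1 then
        (segs.get i).len else 0 := fun j i => h.le_cap _ _
  -- All `P` units pass through the intervals and `γ` takes at most `P - L` of them. The remaining
  -- `L` or more use the direct edges to `ω`, whose total capacity is `L`; hence each of these is
  -- saturated.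
  have hout : ∑ i, φ (Node.interval i) Node.omega = ∑ i : Fin segs.length,
      (segs.get i).lo * (segs.get i).len := by
    refine le_antisymm (Finset.sum_le_sum fun i _ => hω i) ?_
    have h₁ : ∑ i, ∑ j, φ (Node.job j) (Node.interval i) = P := by
      rw [Finset.sum_comm, ← hφ]
      exact Finset.sum_congr rfl fun j _ => h.sum_job j
    simp only [h.sum_interval, Finset.sum_add_distrib, h.sum_gamma] at h₁
    omega
  have hω' := (Finset.sum_eq_sum_iff_of_le fun i _ => hω i).1 hout
  refine ⟨fun j i => ?_, fun j i hji => ?_, fun j => ?_, fun i => ?_, fun i => ?_⟩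
  · refine (hcap j i).trans ?_
    split_ifs <;> simp
  · by_contra hcon
    have := hcap j i
    rw [if_neg hcon] at this
    omega
  · rw [h.sum_job]
    exact (Finset.sum_eq_sum_iff_of_le fun j _ => hα j).1 (hφ.trans hP) j (Finset.mem_univ j)
  · rw [h.sum_interval, hω' i (Finset.mem_univ i)]
    exact Nat.le_add_left _ _
  · rw [h.sum_interval]
    refine (Nat.add_le_add (hγ i) (hω i)).trans ?_
    rw [← Nat.add_mul, Nat.sub_add_cancel (hord _ (segs.get_mem i))]

/-- The flow that corresponds to an allotment. -/
def allotmentFlow (I : Instance n) (segs : List Seg) (P L : ℕ)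
    (x : Fin n → Fin segs.length → ℕ) : Node n segs.length → Node n segs.length → ℕ
  | Sum.inr (Sum.inr 0), Sum.inl j => (I.job j).volume
  | Sum.inl j, Sum.inr (Sum.inl i) => x j i
  | Sum.inr (Sum.inl i), Sum.inr (Sum.inr 1) =>
      ∑ j, x j i - (segs.get i).lo * ((segs.get i).finish - (segs.get i).start)
  | Sum.inr (Sum.inl i), Sum.inr (Sum.inr 2) =>
      (segs.get i).lo * ((segs.get i).finish - (segs.get i).start)
  | Sum.inr (Sum.inr 1), Sum.inr (Sum.inr 2) => P - L
  | _, _ => 0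

/-- The one global condition is conservation at `γ`: the surpluses over the lower bounds sum to `P -
L`, because the allotment has total volume `P`. -/
theorem Instance.IsAllotment.isFlow {x : Fin n → Fin segs.length → ℕ} (h : I.IsAllotment segs x)
    (hP : P = ∑ j, (I.job j).volume)
    (hL : L = ∑ i : Fin segs.length, (segs.get i).lo * (segs.get i).len) :
    (network I segs P L).IsFlow (allotmentFlow I segs P L x) := by
  constructor
  · rintro (j | i | k) (j' | i' | k')
    · exact le_rfl
    · change x j i' ≤ if _ then _ else _
      split_ifs with hw
      · exact h.le_len j i'
      · by_contra hx
        exact hw (h.window j i' (by omega))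
    · exact le_rfl
    · exact le_rfl
    · exact le_rfl
    · fin_cases k'
      · exact le_rfl
      · change ∑ j, x j i - _ ≤ _ * _
        rw [Nat.sub_mul]
        exact Nat.sub_le_sub_right (h.le_up i) _
      · exact le_rfl
    · fin_cases k <;> exact le_rfl
    · fin_cases k <;> exact le_rfl
    · fin_cases k <;> fin_cases k' <;> exact le_rfl
  · rintro (j | i | k) hα hω
    · rw [sum_node, sum_node]
      have := h.volume j
      simp only [allotmentFlow, Finset.sum_const_zero]
      omega
    · rw [sum_node, sum_node]
      have := h.lo_le i
      simp only [Seg.len] at this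
      simp only [allotmentFlow, Finset.sum_const_zero]
      omega
    · fin_cases k
      · exact absurd rfl hα
      · rw [sum_node, sum_node]
        have h₁ : ∑ i : Fin segs.length, (∑ j, x j i - (segs.get i).lo * (segs.get i).len) +
            L = P := by
          rw [hL, ← Finset.sum_add_distrib, hP,
            Finset.sum_congr rfl fun i _ => Nat.sub_add_cancel (h.lo_le i), Finset.sum_comm]
          exact Finset.sum_congr rfl fun j _ => h.volume j
        simp only [allotmentFlow, Finset.sum_const_zero]
        change 0 + (∑ i : Fin segs.length, (∑ j, x j i - (segs.get i).lo * (segs.get i).len) + 0) =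
          0 + (0 + (0 + 0 + (P - L)))
        omega
      · exact absurd rfl hω

end Flow

/-! ### The check decides feasibility -/

namespace Instance

variable {n : ℕ} {I : Instance n} {segs : List Seg} {B : Bounds}

theorem ValidSegs.lo_le_up (hV : I.ValidSegs segs B) (hB : I.FeasibleWith B) :
    ∀ s ∈ segs, s.lo ≤ s.up := by
  obtain ⟨σ, -, hr⟩ := hB
  intro s hs
  have h₁ := hV.tiles.of_mem hs
  have h₂ := hV.stores s hs s.start le_rfl h₁.2.1
  have h₃ := hr s.start (by omega)
  omega

theorem ValidSegs.up_le (hV : I.ValidSegs segs B) {u : ℕ} (hB : ∀ t ≤ I.d, B.up t ≤ u) :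
    ∀ s ∈ segs, s.up ≤ u := by
  intro s hs
  have h₁ := hV.tiles.of_mem hs
  have h₂ := hV.stores s hs s.start le_rfl h₁.2.1
  have h₃ := hB s.start (by omega)
  omega

/-- A feasible schedule that respects the bounds yields an allotment. -/
theorem ValidSegs.exists_isAllotment (hV : I.ValidSegs segs B) (hB : I.FeasibleWith B) :
    ∃ x, I.IsAllotment segs x := by
  obtain ⟨σ, hσ, hr⟩ := hB
  have hT := hV.tiles
  have hsum : ∀ i : Fin segs.length, ∑ j, ((Finset.Ico (segs.get i).start
      (segs.get i).finish).filter fun t => ∃ k, σ k t = some j).card =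
      ∑ t ∈ Finset.Ico (segs.get i).start (segs.get i).finish, σ.vol t := by
    intro i
    simp only [Finset.card_filter]
    rw [Finset.sum_comm]
    refine Finset.sum_congr rfl fun t _ => ?_
    rw [← Finset.card_filter]
    exact hσ.card_running t
  have hbound : ∀ (i : Fin segs.length), ∀ t ∈ Finset.Ico (segs.get i).start (segs.get i).finish,
      (segs.get i).lo ≤ σ.vol t ∧ σ.vol t ≤ (segs.get i).up := by
    intro i t ht
    rw [Finset.mem_Ico] at ht
    have h₁ := hT.of_mem (segs.get_mem i)
    have h₂ := hV.stores _ (segs.get_mem i) t ht.1 ht.2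
    have h₃ := hr t (by omega)
    omega
  refine ⟨fun j i => ((Finset.Ico (segs.get i).start (segs.get i).finish).filter
    fun t => ∃ k, σ k t = some j).card, fun j i => ?_, fun j i hji => ?_, fun j => ?_,
    fun i => ?_, fun i => ?_⟩
  · exact (Finset.card_filter_le _ _).trans (by simp)
  · obtain ⟨t, ht⟩ := Finset.card_ne_zero.1 hji
    rw [Finset.mem_filter, Finset.mem_Ico] at ht
    obtain ⟨⟨h₁, h₂⟩, k, hk⟩ := ht
    have hw := hσ.window k t j hk
    exact hV.window_of_mem (segs.get_mem i) h₁ h₂ hw.1 hw.2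
  · simp only [Finset.card_filter]
    rw [hT.sum_eq, ← Finset.range_eq_Ico, ← Finset.card_filter]
    exact hσ.volume j
  · rw [hsum, mul_comm, ← smul_eq_mul]
    refine (le_of_eq ?_).trans (Finset.card_nsmul_le_sum _ _ _ fun t ht => (hbound i t ht).1)
    simp
  · rw [hsum, mul_comm, ← smul_eq_mul]
    refine (Finset.sum_le_card_nsmul _ _ _ fun t ht => (hbound i t ht).2).trans (le_of_eq ?_)
    simp

theorem IsAllotment.totalLo_le {x : Fin n → Fin segs.length → ℕ} (h : I.IsAllotment segs x) :
    (totalLo segs).val ≤ (totalVolume I).val := by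
  rw [totalLo_val, totalVolume_val, ← Finset.sum_congr rfl fun j _ => h.volume j, Finset.sum_comm]
  exact Finset.sum_le_sum fun i _ => h.lo_le i

variable (A : MaxFlowSolver)

/-- A maximum flow under feasible bounds yields an allotment. -/
theorem ValidSegs.runFlow_isAllotment (hV : I.ValidSegs segs B) (hB : I.FeasibleWith B) :
    (∑ j, (runFlow A I segs (totalVolume I).val (totalLo segs).val).val Node.alpha (Node.job j) =
      (totalVolume I).val) ∧ I.IsAllotment segs fun j i =>
      (runFlow A I segs (totalVolume I).val (totalLo segs).val).val (Node.job j)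
        (Node.interval i) := by
  obtain ⟨x, hx⟩ := hV.exists_isAllotment hB
  have hmax := A.isMaxFlow (network I segs (totalVolume I).val (totalLo segs).val)
  have hflow := hx.isFlow (totalVolume_val I) (totalLo_val segs)
  have hle := hmax.2 _ hflow
  rw [hflow.value_eq, hmax.1.value_eq, Nat.cast_le] at hle
  have heq : ∑ j, (A.solve (network I segs (totalVolume I).val (totalLo segs).val)).val
      Node.alpha (Node.job j) = (totalVolume I).val := by
    refine le_antisymm ?_ (le_trans (le_of_eq (totalVolume_val I)) hle)
    exact (Finset.sum_le_sum fun j _ => hmax.1.le_cap _ _).trans (totalVolume_val I).ge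
  exact ⟨heq, hmax.1.isAllotment (totalVolume_val I) (totalLo_val segs) hx.totalLo_le
    (hV.lo_le_up hB) heq⟩

/-- The check decides feasibility. -/
theorem ValidSegs.check_val (hV : I.ValidSegs segs B) (hm : ∀ t ≤ I.d, B.up t ≤ I.m) :
    (check A I segs).val = true ↔ I.FeasibleWith B := by
  constructor
  · intro h
    simp only [check, bind_val] at h
    split_ifs at h with hok
    · simp only [bind_val, pure_val, fold_val, decide_eq_true_eq] at h
      rw [foldl_add_eq_sum (fun j => (runFlow A I segs (totalVolume I).val
        (totalLo segs).val).val Node.alpha (Node.job j)), zero_add, sum_map_finRange] at h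
      have hmax := A.isMaxFlow (network I segs (totalVolume I).val (totalLo segs).val)
      have hx := hmax.1.isAllotment (totalVolume_val I) (totalLo_val segs) hok.2
        ((ordered_val segs).1 hok.1) h
      exact ⟨_, hx.isFeasible hV (hV.up_le hm), hx.respects hV (hV.up_le hm)⟩
  · intro h
    obtain ⟨x, hx⟩ := hV.exists_isAllotment h
    simp only [check, bind_val]
    rw [if_pos ⟨(ordered_val segs).2 (hV.lo_le_up h), hx.totalLo_le⟩]
    simp only [bind_val, pure_val, fold_val, decide_eq_true_eq]
    rw [foldl_add_eq_sum (fun j => (runFlow A I segs (totalVolume I).val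
      (totalLo segs).val).val Node.alpha (Node.job j)), zero_add, sum_map_finRange]
    exact (hV.runFlow_isAllotment A h).1

end Instance

/-- The algorithm takes at most `f` steps on every network with at most `N` nodes. -/
def MaxFlowSolver.TimeBound (A : MaxFlowSolver) (N f : ℕ) : Prop :=
  ∀ (V : Type) [Fintype V] [DecidableEq V] (G : FlowNetwork V),
    Fintype.card V ≤ N → (A.solve G).time ≤ f

/-- Even the zero network on `a` nodes costs `a ^ 2` steps. This is how linear and quadratic
bookkeeping gets absorbed into `f`. -/
theorem MaxFlowSolver.TimeBound.sq_le {A : MaxFlowSolver} {N f : ℕ} (h : A.TimeBound N f)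
    {a : ℕ} (ha : a ≤ N) : a ^ 2 ≤ f := by
  rcases Nat.eq_zero_or_pos a with rfl | hpos
  · simp
  · have h₁ := A.card_sq_le (V := Fin a) ⟨fun _ _ => 0, ⟨0, hpos⟩, ⟨0, hpos⟩⟩
    rw [Fintype.card_fin] at h₁
    exact h₁.trans (h (Fin a) _ (by simpa using ha))

theorem card_node (n s : ℕ) : Fintype.card (Node n s) = n + s + 3 := by
  simp [Node, add_assoc]

theorem runFlow_time_le {A : MaxFlowSolver} {N f n : ℕ} (h : A.TimeBound N f) (I : Instance n)
    {segs : List Seg} (P L : ℕ) (hN : n + segs.length + 3 ≤ N) :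
    (runFlow A I segs P L).time ≤ 2 * f := by
  simp only [runFlow, bind_time, tick_time, card_node]
  have h₁ := h.sq_le hN
  have h₂ := h _ (network I segs P L) (by rwa [card_node])
  omega

/-- The flow with its capacity table costs `2 * f`, and the linear passes together cost at most `2 *
(n + segs.length + 3) ≤ f`. -/
theorem check_time_le {A : MaxFlowSolver} {N f n : ℕ} (h : A.TimeBound N f) (I : Instance n)
    {segs : List Seg} (hN : n + segs.length + 3 ≤ N) : (check A I segs).time ≤ 4 * f := by
  have h₁ := totalVolume_time_le I
  have h₂ := totalLo_time_le segs
  have h₃ := ordered_time_le segs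
  have h₄ := runFlow_time_le h I (totalVolume I).val (totalLo segs).val hN
  have h₅ : 2 * (n + segs.length + 3) ≤ f := (by nlinarith : _ ≤ (n + segs.length + 3) ^ 2).trans
    (h.sq_le hN)
  simp only [check, bind_time]
  split_ifs
  · have h₆ : ∀ φ : Node n segs.length → Node n segs.length → ℕ,
        (fold (fun x j => (pure (x + φ Node.alpha (Node.job j)) : Timed ℕ)) 0
          (List.finRange n)).time ≤ n + 1 := fun φ =>
      (fold_time_le _ _ _ 0 (by simp)).trans (by simp)
    have h₇ := h₆ (runFlow A I segs (totalVolume I).val (totalLo segs).val).val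
    simp only [bind_time, pure_time]
    omega
  · simp only [pure_time]
    omega

/-! ## The loops of the program -/

namespace Instance

variable {n : ℕ} {I : Instance n} {segs : List Seg} {B : Bounds} (A : MaxFlowSolver)

/-- Binary search is justified because a longer stretch means tighter bounds. This uses `k - 1 ≤
B.up s`: the assignment never raises an upper bound. -/
theorem ValidSegs.keepIdle (hV : I.ValidSegs segs B) {k t : ℕ} (ht : t ≤ I.d + 1)
    (hB : I.FeasibleWith B) (hup : ∀ s ≤ I.d, k - 1 ≤ B.up s ∧ B.up s ≤ I.m) :
    I.IsKeepIdle B k t (keepIdle A I I.d k t segs).val.1 ∧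
      I.ValidSegs (keepIdle A I I.d k t segs).val.2
        (B.setIdle k t (keepIdle A I I.d k t segs).val.1) := by
  have hcheck : ∀ x, (check A I (setIdleSegs k t x segs).val).val = true ↔
      I.FeasibleWith (B.setIdle k t x) := fun x =>
    (hV.setIdle k t x).check_val A fun s hs => by
      have := hup s hs
      simp only [Bounds.setIdle]
      split_ifs <;> omega
  refine ⟨?_, hV.setIdle _ _ _⟩
  have := isGreatest_search (fun x => do
    let segs' ← setIdleSegs k t x segs
    check A I segs') t (I.d + 1) ht
    ((hcheck t).2 (by rwa [Bounds.setIdle_self])) fun x y hx hxy hy h =>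
      (hcheck x).2 (((hcheck y).1 h).mono fun s hs => ⟨le_rfl, by
        have := hup s hs
        simp only [Bounds.setIdle]
        split_ifs <;> omega⟩)
  simp only [bind_val, hcheck] at this
  exact this

theorem ValidSegs.keepBusy (hV : I.ValidSegs segs B) {k t : ℕ} (ht : t ≤ I.d + 1)
    (hB : I.FeasibleWith B) (hup : ∀ s ≤ I.d, B.up s ≤ I.m) :
    I.IsKeepBusy B k t (keepBusy A I I.d k t segs).val.1 ∧
      I.ValidSegs (keepBusy A I I.d k t segs).val.2
        (B.setBusy k t (keepBusy A I I.d k t segs).val.1) := by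
  have hcheck : ∀ x, (check A I (setBusySegs k t x segs).val).val = true ↔
      I.FeasibleWith (B.setBusy k t x) := fun x =>
    (hV.setBusy k t x).check_val A hup
  refine ⟨?_, hV.setBusy _ _ _⟩
  have := isGreatest_search (fun x => do
    let segs' ← setBusySegs k t x segs
    check A I segs') t (I.d + 1) ht
    ((hcheck t).2 (by rwa [Bounds.setBusy_self])) fun x y hx hxy hy h =>
      (hcheck x).2 (((hcheck y).1 h).mono fun s hs => ⟨by
        simp only [Bounds.setBusy]
        split_ifs <;> omega, le_rfl⟩)
  simp only [bind_val, hcheck] at this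
  exact this

end Instance

/-! ### Cost of one call of keepidle or keepbusy -/

section Time

variable {A : MaxFlowSolver} {N f e n : ℕ} {I : Instance n} {segs : List Seg}

theorem length_keepIdle (A : MaxFlowSolver) (I : Instance n) (d k t : ℕ) (segs : List Seg) :
    segs.length ≤ (keepIdle A I d k t segs).val.2.length ∧
      (keepIdle A I d k t segs).val.2.length ≤ segs.length + 2 :=
  length_setIdleSegs _ _ _ _

theorem length_keepBusy (A : MaxFlowSolver) (I : Instance n) (d k t : ℕ) (segs : List Seg) :
    segs.length ≤ (keepBusy A I d k t segs).val.2.length ∧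
      (keepBusy A I d k t segs).val.2.length ≤ segs.length + 2 :=
  length_setBusySegs _ _ _ _

/-- The summand `5` stands for three special nodes and two segments created by splitting. A probe
costs at most `f` for the update and `4 * f` for the check. -/
theorem search_time_le_mul (hA : A.TimeBound N f) (he : 1 ≤ e) {d t : ℕ} (hd : d + 1 < 2 ^ e)
    (hN : n + segs.length + 5 ≤ N) {g : ℕ → Timed (List Seg)}
    (hg : ∀ x, (g x).time ≤ 3 * segs.length + 6)
    (hlen : ∀ x, (g x).val.length ≤ segs.length + 2) (y : ℕ) :
    (search (fun x => do
      let segs' ← g x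
      check A I segs') t (d + 1)).time + (g y).time ≤ 8 * e * f := by
  have hf := hA.sq_le hN
  have h₁ : 3 * segs.length + 8 ≤ f := le_trans (by nlinarith) hf
  have h₂ := search_time_le (fun x => do
      let segs' ← g x
      check A I segs') t (d + 1) e (5 * f) (by omega) fun x => by
    have h₃ := hg x
    have h₄ := check_time_le hA I (segs := (g x).val) (by have := hlen x; omega)
    simp only [bind_time]
    omega
  have h₃ := hg y
  have h₄ : f ≤ e * f := Nat.le_mul_of_pos_left _ he
  have h₅ : e * (5 * f + 1) ≤ e * (6 * f) := Nat.mul_le_mul_left _ (by omega)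
  nlinarith

theorem keepIdle_time_le (hA : A.TimeBound N f) (he : 1 ≤ e) {d k t : ℕ} (hd : d + 1 < 2 ^ e)
    (hN : n + segs.length + 5 ≤ N) : (keepIdle A I d k t segs).time ≤ 8 * e * f := by
  have := search_time_le_mul (I := I) (t := t) hA he hd hN
    (fun x => setIdleSegs_time_le k t x segs) (fun x => (length_setIdleSegs k t x segs).2)
    (keepIdle A I d k t segs).val.1
  exact this

theorem keepBusy_time_le (hA : A.TimeBound N f) (he : 1 ≤ e) {d k t : ℕ} (hd : d + 1 < 2 ^ e)
    (hN : n + segs.length + 5 ≤ N) : (keepBusy A I d k t segs).time ≤ 8 * e * f := by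
  have := search_time_le_mul (I := I) (t := t) hA he hd hN
    (fun x => setBusySegs_time_le k t x segs) (fun x => (length_setBusySegs k t x segs).2)
    (keepBusy A I d k t segs).val.1
  exact this

end Time

namespace Instance

variable {n : ℕ} {I : Instance n} {segs : List Seg} {B : Bounds}

/-- Lists never shrink, so it suffices that the final one fits into `N`. A round makes at most four
splits and costs two searches of `8 * e * f` plus one step. The limit `r` does not cut the loop
short, since `t` grows in every round that continues. -/
theorem ValidSegs.scan (A : MaxFlowSolver) {k t r : ℕ} (hV : I.ValidSegs segs B)
    (hB : I.FeasibleWith B) (hup : ∀ s ≤ I.d, k - 1 ≤ B.up s ∧ B.up s ≤ I.m)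
    (hr : I.d < t + r) : ∃ B' R, I.CountedScan k R t B B' ∧
      I.ValidSegs (scan A I I.d k r t segs).val B' ∧
      segs.length ≤ (scan A I I.d k r t segs).val.length ∧
      (scan A I I.d k r t segs).val.length ≤ segs.length + 4 * R ∧
      ∀ N f e, A.TimeBound N f → 1 ≤ e → I.d + 1 < 2 ^ e →
        n + (scan A I I.d k r t segs).val.length + 5 ≤ N →
        (scan A I I.d k r t segs).time ≤ 17 * e * f * R + 1 := by
  induction r generalizing t segs B with
  | zero => exact ⟨B, 0, .done t B (by omega), hV, le_rfl, le_rfl, fun _ _ _ _ _ _ _ => by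
      simp [PowerDown.scan]⟩
  | succ r ih =>
    simp only [PowerDown.scan, bind_val, bind_time, tick_time]
    split_ifs with hd
    · exact ⟨B, 0, .done t B hd, hV, le_rfl, le_rfl, fun _ _ _ _ _ _ _ => by simp⟩
    · obtain ⟨h₁, hV₁⟩ := hV.keepIdle A (k := k) (t := t) (by omega) hB hup
      have hlen₁ := length_keepIdle A I I.d k t segs
      simp only [bind_val, bind_time]
      set r₁ := (PowerDown.keepIdle A I I.d k t segs).val with hr₁
      have hB₁ := h₁.1.2.2
      have hup₁ : ∀ s ≤ I.d, k - 1 ≤ (B.setIdle k t r₁.1).up s ∧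
          (B.setIdle k t r₁.1).up s ≤ I.m := fun s hs => by
        have := hup s hs
        simp only [Bounds.setIdle]
        split_ifs <;> omega
      have hone : ∀ {N f e : ℕ}, A.TimeBound N f → 1 ≤ e → n + r₁.2.length + 5 ≤ N →
          1 ≤ e * f := fun hA he hN => by
        have : 1 ≤ _ := le_trans (by nlinarith) (hA.sq_le hN)
        exact Nat.mul_pos he this
      split_ifs with hd₁
      -- The program skips keepbusy here; the corresponding call in the specification returns `d +
      -- 1` and changes nothing.
      · have heq : r₁.1 = I.d + 1 := le_antisymm h₁.1.2.1 hd₁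
        refine ⟨_, 1, .step 0 t r₁.1 r₁.1 B _ (by omega) h₁
          ⟨⟨le_rfl, h₁.1.2.1, ?_⟩, fun s hs => by have := hs.2.1; omega⟩ (.done _ _ hd₁),
          ?_, hlen₁.1, by simp only [pure_val]; omega, fun N f e hA he hde hN => ?_⟩
        · rwa [Bounds.setBusy_self]
        · rwa [Bounds.setBusy_self]
        · simp only [pure_val] at hN
          have h₂ := keepIdle_time_le (I := I) (segs := segs) (k := k) (t := t) hA he hde
            (by omega)
          have h₃ := hone hA he hN
          simp only [pure_time]
          nlinarith
      · obtain ⟨h₂, hV₂⟩ := hV₁.keepBusy A (k := k) (t := r₁.1) (by omega) hB₁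
          fun s hs => (hup₁ s hs).2
        have hlen₂ := length_keepBusy A I I.d k r₁.1 r₁.2
        simp only [bind_val, bind_time]
        set r₂ := (PowerDown.keepBusy A I I.d k r₁.1 r₁.2).val with hr₂
        have hlt := IsKeepBusy.lt_of_isKeepIdle h₁ h₂ (by omega)
        have hle := h₁.1.1
        obtain ⟨B', R, h₃, hV₃, hlen₃, hlen₄, htime⟩ := ih (t := r₂.1) hV₂ h₂.1.2.2
          (fun s hs => hup₁ s hs) (by omega)
        refine ⟨B', R + 1, .step R t r₁.1 r₂.1 B B' (by omega) h₁ h₂ h₃, hV₃, by omega, by omega,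
          fun N f e hA he hde hN => ?_⟩
        have h₄ := keepIdle_time_le (I := I) (segs := segs) (k := k) (t := t) hA he hde
          (by omega)
        have h₅ := keepBusy_time_le (I := I) (segs := r₁.2) (k := k) (t := r₁.1) hA he hde
          (by omega)
        have h₆ := hone hA he (by omega)
        have h₇ := htime N f e hA he hde hN
        nlinarith

theorem ValidSegs.scanAll (A : MaxFlowSolver) {k : ℕ} (hV : I.ValidSegs segs B)
    (hB : I.FeasibleWith B) (hup : ∀ s ≤ I.d, k ≤ B.up s ∧ B.up s ≤ I.m) :
    ∃ B' R, I.CountedScans k R B B' ∧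
      I.ValidSegs (scanAll A I I.d k segs).val B' ∧
      (∀ s ≤ I.d, B'.up s ≤ I.m) ∧
      segs.length ≤ (scanAll A I I.d k segs).val.length ∧
      (scanAll A I I.d k segs).val.length ≤ segs.length + 4 * R ∧
      ∀ N f e, A.TimeBound N f → 1 ≤ e → I.d + 1 < 2 ^ e →
        n + (scanAll A I I.d k segs).val.length + 5 ≤ N →
        (scanAll A I I.d k segs).time ≤ 17 * e * f * R + 2 * k + 1 := by
  induction k generalizing segs B with
  | zero => exact ⟨B, 0, .zero B, hV, fun s hs => (hup s hs).2, le_rfl, le_rfl,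
      fun _ _ _ _ _ _ _ => by simp [PowerDown.scanAll]⟩
  | succ k ih =>
    simp only [PowerDown.scanAll, bind_val, bind_time, tick_time]
    obtain ⟨B₁, R₁, h₁, hV₁, hlen₁, hlen₂, htime₁⟩ := hV.scan A (k := k + 1) (t := 0)
      (r := I.d + 1) hB (fun s hs => by have := hup s hs; omega) (by omega)
    obtain ⟨B₂, R₂, h₂, hV₂, hm, hlen₃, hlen₄, htime₂⟩ := ih hV₁ (h₁.feasibleWith hB)
      fun s hs => by
        have := hup s hs
        have := h₁.up_le s (by omega)
        omega
    refine ⟨B₂, R₁ + R₂, .succ k R₁ R₂ B B₁ B₂ h₁ h₂, hV₂, hm, by omega, by omega,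
      fun N f e hA he hde hN => ?_⟩
    have h₃ := htime₁ N f e hA he hde (by omega)
    have h₄ := htime₂ N f e hA he hde hN
    nlinarith

end Instance

/-! ## The whole program -/

/-- Cuts survive later splits, so the result refines all execution intervals. The quadratic time is
affordable because `f` dominates `n ^ 2`. -/
theorem splitAt_jobs {n : ℕ} (I : Instance n) {B : Bounds} (l : List (Fin n)) {segs : List Seg}
    (hT : Tiles 0 (I.d + 1) segs) (hS : ∀ s ∈ segs, s.Stores B) {r : Timed (List Seg)}
    (hr : r = fold (fun segs j => do
      let segs₁ ← splitAt (I.job j).release segs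
      splitAt ((I.job j).deadline + 1) segs₁) segs l) :
    Tiles 0 (I.d + 1) r.val ∧ (∀ s ∈ r.val, s.Stores B) ∧
      (∀ x, CutAt x segs → CutAt x r.val) ∧
      (∀ j ∈ l, CutAt (I.job j).release r.val ∧ CutAt ((I.job j).deadline + 1) r.val) ∧
      r.val.length ≤ segs.length + 2 * l.length ∧
      r.time ≤ l.length * (2 * (segs.length + 2 * l.length) + 4) + 1 := by
  subst hr
  induction l generalizing segs with
  | nil => exact ⟨hT, hS, fun _ h => h, by simp, le_rfl, by simp [fold]⟩
  | cons j l ih =>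
    simp only [fold, bind_val, bind_time, tick_time, List.length_cons]
    have hT₁ := tiles_splitAt (I.job j).release hT
    have hl₁ := length_splitAt (I.job j).release segs
    have ht₁ := splitAt_time_le (I.job j).release segs
    set segs₁ := (splitAt (I.job j).release segs).val with hs₁
    have hl₂ := length_splitAt ((I.job j).deadline + 1) segs₁
    have ht₂ := splitAt_time_le ((I.job j).deadline + 1) segs₁
    obtain ⟨h₁, h₂, h₃, h₄, h₅, h₆⟩ := ih (tiles_splitAt ((I.job j).deadline + 1) hT₁)
      (stores_of_mem_splitAt (stores_of_mem_splitAt hS))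
    refine ⟨h₁, h₂, fun x hx => h₃ x hx.splitAt.splitAt, fun j' hj' => ?_, by omega, ?_⟩
    · rcases List.mem_cons.1 hj' with rfl | hj'
      · exact ⟨h₃ _ (cutAt_splitAt_self _ hT).splitAt, h₃ _ (cutAt_splitAt_self _ hT₁)⟩
      · exact h₄ j' hj'
    · have h₇ : l.length * (2 * ((splitAt ((I.job j).deadline + 1) segs₁).val.length +
          2 * l.length) + 4) ≤ l.length * (2 * (segs.length + 2 * (l.length + 1)) + 4) :=
        Nat.mul_le_mul_left _ (by omega)
      have h₈ := h₆.trans (Nat.add_le_add_right h₇ 1)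
      rw [Nat.add_mul _ 1]
      omega

namespace Instance

variable {n : ℕ} {I : Instance n} {segs : List Seg} {B : Bounds}

theorem ValidSegs.extract (A : MaxFlowSolver) (hV : I.ValidSegs segs B) (hB : I.FeasibleWith B)
    (hm : ∀ t ≤ I.d, B.up t ≤ I.m) : ∃ σ : Schedule I.m n, I.IsFeasible σ ∧ I.Respects σ B ∧
      σ.Stair ∧ Describes (extract A I segs).val σ := by
  have hx := (hV.runFlow_isAllotment A hB).2
  exact ⟨_, hx.isFeasible hV (hV.up_le hm), hx.respects hV (hV.up_le hm),
    wrapAround_stair hV.tiles _, describes_wrapAround hV.tiles hx.le_len fun i =>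
      (hx.le_up i).trans (Nat.mul_le_mul_right _ (hV.up_le hm _ (segs.get_mem i)))⟩

theorem extract_time_le {A : MaxFlowSolver} {N f : ℕ} (hA : A.TimeBound N f) (I : Instance n)
    (hN : n + segs.length + 3 ≤ N) : (PowerDown.extract A I segs).time ≤ 3 * f := by
  have h₁ := totalVolume_time_le I
  have h₂ := totalLo_time_le segs
  have h₃ := runFlow_time_le hA I (totalVolume I).val (totalLo segs).val hN
  simp only [PowerDown.extract, bind_time]
  have h₄ := fold_time_le (fun pieces i => fillInterval (segs.get i).start
    ((segs.get i).finish - (segs.get i).start) (fun j => (runFlow A I segs (totalVolume I).val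
      (totalLo segs).val).val (Node.job j) (Node.interval i)) pieces) []
    (List.finRange segs.length) (n + 1) fun _ _ _ => fillInterval_time_le _ _ _ _
  rw [List.length_finRange] at h₄
  have h₅ := hA.sq_le hN
  have h₆ : n + 1 + (segs.length + 1) + (segs.length * (n + 1 + 1) + 1) ≤
      (n + segs.length + 3) ^ 2 := by nlinarith
  omega

/-- The processors beyond the number of jobs need not be considered. -/
theorem exists_initial_bounds (hI : I.Feasible) : ∃ B₀ : Bounds, (∀ s, B₀.lo s = 0) ∧
    (∀ s ≤ I.d, B₀.up s = min I.m n) ∧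
    ∀ B', I.ScanProcessors (min I.m n) B₀ B' → I.PLTRReturns B' := by
  rcases le_total I.m n with h | h
  · rw [min_eq_left h]
    exact ⟨⟨fun _ => 0, fun _ => I.m⟩, fun _ => rfl, fun _ _ => rfl, fun _ h => h⟩
  · rw [min_eq_right h]
    obtain ⟨B₀, h₁, h₂, h₃⟩ := ScanProcessors.of_idle hI le_rfl (I.m - n)
      (B := ⟨fun _ => 0, fun _ => I.m⟩) (fun _ => rfl) (fun _ _ => by simp only; omega)
    refine ⟨B₀, h₁, h₂, fun B' hB' => ?_⟩
    have := h₃ B' hB'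
    rwa [Nat.add_sub_cancel' h] at this

end Instance

/-- At most `1 + 2 * n` initial segments and `4` more in each of at most `4 * n` rounds, with `n`
jobs and the summand `5`, give `19 * n + 6 ≤ 25 * n`. The factor `72` is `17 * 4` for the rounds,
`3` for the extraction and `1` for the bookkeeping. -/
theorem pltr_spec (A : MaxFlowSolver) {n : ℕ} (hn : 1 ≤ n) (I : Instance n) (hI : I.Feasible) :
    (∃ B : Bounds, I.PLTRReturns B ∧ I.Stores (pltr A I).val.segs B ∧
      ∃ σ : Schedule I.m n, I.IsFeasible σ ∧ I.Respects σ B ∧ σ.Stair ∧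
        Describes (pltr A I).val.pieces σ) ∧
    ∀ f e, A.TimeBound (25 * n) f → 1 ≤ e → I.d + 1 < 2 ^ e →
      (pltr A I).time ≤ 72 * n * f * e := by
  obtain ⟨B₀, hlo, hup, hret⟩ := I.exists_initial_bounds hI
  have hB₀ : I.FeasibleWith B₀ := by
    obtain ⟨σ, hσ⟩ := hI
    refine ⟨σ, hσ, fun t ht => ⟨by simp [hlo], ?_⟩⟩
    rw [hup t ht]
    exact le_min ((Finset.card_le_univ _).trans (by simp)) (hσ.vol_le t)
  obtain ⟨segs₀, hsegs₀⟩ : ∃ r : Timed (List Seg), r = fold (fun segs j => do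
      let segs₁ ← splitAt (I.job j).release segs
      splitAt ((I.job j).deadline + 1) segs₁) [⟨0, I.d + 1, 0, min I.m n⟩] (List.finRange n) :=
    ⟨_, rfl⟩
  obtain ⟨hT, hS, -, hcut, hlen₀, htime₀⟩ := splitAt_jobs I (B := B₀) _
    (by simp [Tiles]) (fun s hs t h₁ h₂ => by
      obtain rfl := List.mem_singleton.1 hs
      exact ⟨hlo t, hup t (Nat.lt_succ_iff.1 h₂)⟩) hsegs₀
  have hV₀ : I.ValidSegs segs₀.val B₀ :=
    ⟨hT, hS, fun j => (hcut j (by simp)).1, fun j => (hcut j (by simp)).2⟩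
  obtain ⟨B, R, hscan, hV, hm, hlen₁, hlen₂, htime⟩ := hV₀.scanAll A (k := min I.m n) hB₀
    fun s hs => ⟨(hup s hs).ge, (hup s hs).le.trans (min_le_left _ _)⟩
  have hB := hscan.feasibleWith hB₀
  have hR := hscan.rounds_le_mul hup (fun s _ => hlo s) (min_le_right _ _) hB
  obtain ⟨σ, hσ⟩ := hV.extract A hB hm
  simp only [List.length_finRange, List.length_singleton] at hlen₀ htime₀
  simp only [pltr, bind_val, bind_time, pure_val, pure_time, lastDeadline_val, ← hsegs₀]
  refine ⟨⟨B, hret B hscan.scanProcessors, hV.toStores, σ, hσ⟩, fun f e hA he hde => ?_⟩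
  have h₁ := htime _ f e hA he hde (by omega)
  have h₂ := Instance.extract_time_le hA I
    (segs := (scanAll A I I.d (min I.m n) segs₀.val).val) (by omega)
  have h₃ := lastDeadline_time_le I
  -- The value `16 * n ^ 2` is large enough for the bookkeeping terms collected in `h₈`.
  have h₄ := hA.sq_le (a := 4 * n) (by omega)
  have h₅ : 17 * e * f * R ≤ 17 * e * f * (4 * n) := Nat.mul_le_mul_left _ hR
  have h₆ : f ≤ n * f * e := by
    calc f = 1 * f * 1 := by ring
      _ ≤ n * f * e := Nat.mul_le_mul (Nat.mul_le_mul_right _ hn) he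
  have h₇ : min I.m n ≤ n := min_le_right _ _
  have h₈ : n + 1 + (n * (2 * (1 + 2 * n) + 4) + 1) + (2 * n + 1) ≤ f := by nlinarith
  have h₉ : 17 * e * f * (4 * n) = 68 * (n * f * e) := by ring
  have h₁₀ : 72 * n * f * e = 72 * (n * f * e) := by ring
  omega

/-- From `d + 1 ≤ d ^ 2` and `log 2 ≤ log d` one gets `e ≤ 3 * log d / log 2`, and `3 / log 2 < 5`.
-/
theorem exists_pow_two_bound {d : ℕ} (hd : 2 ≤ d) :
    ∃ e : ℕ, 1 ≤ e ∧ d + 1 < 2 ^ e ∧ (e : ℝ) ≤ 5 * Real.log d := by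
  refine ⟨Nat.log 2 (d + 1) + 1, by omega, Nat.lt_pow_succ_log_self (by norm_num) _, ?_⟩
  have hd' : (2 : ℝ) ≤ d := by exact_mod_cast hd
  have h₁ : (2 : ℝ) ^ Nat.log 2 (d + 1) ≤ (d : ℝ) ^ 2 := by
    have : 2 ^ Nat.log 2 (d + 1) ≤ d ^ 2 :=
      (Nat.pow_log_le_self 2 (by omega)).trans (by nlinarith)
    exact_mod_cast this
  have h₂ := Real.log_le_log (by positivity) h₁
  rw [Real.log_pow, Real.log_pow] at h₂
  have h₃ := Real.log_le_log (by norm_num) hd'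
  have h₄ := Real.log_two_gt_d9
  push_cast at h₂ ⊢
  nlinarith [Nat.cast_nonneg (α := ℝ) (Nat.log 2 (d + 1))]

end PowerDown

theorem mainTheorem4 :
    ∃ c C : ℕ, ∀ (A : PowerDown.MaxFlowSolver) (n : ℕ) (I : PowerDown.Instance n),
      I.Feasible → 2 ≤ I.d →
      ∀ f : ℕ,
        (∀ (V : Type) [Fintype V] [DecidableEq V] (G : PowerDown.FlowNetwork V),
          Fintype.card V ≤ c * n → (A.solve G).time ≤ f) →
        (∃ B : PowerDown.Bounds,
          I.PLTRReturns B ∧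
          I.Stores (PowerDown.pltr A I).val.segs B ∧
          ∃ σ : PowerDown.Schedule I.m n,
            I.IsFeasible σ ∧ I.Respects σ B ∧ σ.Stair ∧
            PowerDown.Describes (PowerDown.pltr A I).val.pieces σ) ∧
        ((PowerDown.pltr A I).time : ℝ) ≤ C * n * f * Real.log I.d := by
  -- Here `360 = 72 * 5`, where `5` comes from passing to the natural logarithm.
  refine ⟨25, 360, fun A n I hI hd f hA => ?_⟩
  have hn : 1 ≤ n := by
    by_contra hn
    obtain rfl : n = 0 := by omega
    simp [PowerDown.Instance.d] at hd
  obtain ⟨h₁, h₂⟩ := PowerDown.pltr_spec A hn I hI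
  refine ⟨h₁, ?_⟩
  obtain ⟨e, he, hde, hlog⟩ := PowerDown.exists_pow_two_bound hd
  have h₃ : ((PowerDown.pltr A I).time : ℝ) ≤ 72 * n * f * e := by
    exact_mod_cast h₂ f e hA he hde
  calc ((PowerDown.pltr A I).time : ℝ) ≤ 72 * n * f * e := h₃
    _ ≤ 72 * n * f * (5 * Real.log I.d) := mul_le_mul_of_nonneg_left hlog (by positivity)
    _ = _ := by push_cast; ring
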